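/- For $p=(p^x,p^y)\in\mathbb{Z}^2$ let $Q^1_p=\{q: q^x\ge p^x,\ q^y\ge p^y\}$ and $Q^3_p=\{q: q^x\le p^x,\ q^y\le p^y\}$. A pair $(p,q)$ has nonnegative slope if $q\in Q^1_p\cup Q^3_p$. Points $p,q$ are grid neighbours if $|p^x-q^x|+|p^y-q^y|=1$. Let $R$ be a system of nonnegative sloped digital segments, that is, a set $R_p(q)\subseteq\mathbb{Z}^2$ for every pair $(p,q)$ of nonnegative slope. It is a consistent digital segment system (CDS) if the following hold, where all pairs whose segment is mentioned have nonnegative slope. - (S1) $R_p(q)$ is the set of points of a path from $p$ to $q$ in the grid topology, i.e. the grid graph restricted to $R_p(q)$ is a path with ends $p$ and $q$. - (S2) $R_p(q)=R_q(p)$. - (S3) If $r,s\in R_p(q)$, then $R_r(s)\subseteq R_p(q)$. - (S4) For all $p,q$ there is $r\notin R_p(q)$ with $R_p(q)\subseteq R_p(r)$. - (S5) If $p^x=q^x$, then $r^x=p^x$ for all $r\in R_p(q)$; if $p^y=q^y$, then $r^y=p^y$ for all $r\in R_p(q)$. Let $\prec$ be a strict total order on $\mathbb{Z}$ and $q\in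 Q^1_p$. The segment from $p$ to $q$ generated by $\prec$ is the set of points of the walk of $(q^x-p^x)+(q^y-p^y)$ unit steps that starts at $p$ and, at a point $r$, moves up if $r^x+r^y$ is among the $q^y-p^y$ greatest elements of $I(p,q)=[p^x+p^y,\,q^x+q^y-1]$ with respect to $\prec$, and moves right otherwise. Given total orders $\prec_{p_1},\prec_{p_2}$ for points $p_1,p_2$ and an integer $C\ge p_i^x+p_i^y$ ($i=1,2$), the layout view lists, for $i=1,2$, the interval $[p_i^x+p_i^y,C]$ sorted increasingly by $\prec_{p_i}$ in a row whose first entry is in column $p_i^x$ and whose entries occupy consecutive columns. The orders $\prec_{p_1},\prec_{p_2}$ have a bad pair if for some such $C$ there are integers $a,b$ in both intervals and a vertical line between two consecutive columns such that, in the row of $p_1$, $a$ is to the left and $b$ to the right of the line, while in the row of $p_2$, $b$ is to the left and $a$ to the right of the line. **Theorem.** A system $R$ of nonnegative sloped digital segments in $\mathbb{Z}^2$ is a CDS if and only if one can assign to every $p\in\mathbb{Z}^2$ a total order $\prec^1_p$ on $\mathbb{Z}$ such that 1. for all $p$ and all $q\in Q^1_p$, $R_p(q)$ is the segment from $p$ to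 $q$ generated by $\prec^1_p$; 2. for all $p_1,p_2\in\mathbb{Z}^2$, the orders $\prec^1_{p_1}$ and $\prec^1_{p_2}$ have no bad pair; 3. the third-quadrant segments are induced by the first-quadrant ones: $R_p(q)=R_q(p)$ for all $p$ and all $q\in Q^3_p$. -/

import Mathlib

/-- Grid neighbours: the points of `ℤ × ℤ` at `L¹`-distance one. -/
def gridGraph : SimpleGraph (ℤ × ℤ) where
  Adj p q := |p.1 - q.1| + |p.2 - q.2| = 1
  symm := ⟨fun p q h => by rwa [abs_sub_comm q.1, abs_sub_comm q.2]⟩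
  loopless := ⟨fun p h => by simp at h⟩

/-- The (closed) first quadrant `Q¹_p`. -/
def firstQuadrant (p : ℤ × ℤ) : Set (ℤ × ℤ) := {q | p.1 ≤ q.1 ∧ p.2 ≤ q.2}

/-- The (closed) third quadrant `Q³_p`. -/
def thirdQuadrant (p : ℤ × ℤ) : Set (ℤ × ℤ) := {q | q.1 ≤ p.1 ∧ q.2 ≤ p.2}

/-- The segment with endpoints `p` and `q` has nonnegative slope. -/
def NonnegSlope (p q : ℤ × ℤ) : Prop := q ∈ firstQuadrant p ∨ q ∈ thirdQuadrant p

/-- The points of `S` form a path from `p` to `q` in the grid topology: the grid graph restricted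
to `S` is a path with ends `p` and `q`. That is, `S` is the vertex set of a path from `p` to `q`,
and any two points of `S` that are grid neighbours are consecutive on that path. -/
def IsGridPath (S : Set (ℤ × ℤ)) (p q : ℤ × ℤ) : Prop :=
  ∃ w : gridGraph.Walk p q, w.IsPath ∧ {v | v ∈ w.support} = S ∧
    ∀ r ∈ S, ∀ s ∈ S, gridGraph.Adj r s → s(r, s) ∈ w.edges

/-- A system of nonnegative sloped digital segments that is consistent: the axioms (S1)-(S5),
read for the segments of the system, i.e. for pairs of points of nonnegative slope. The values of
`R` at other pairs play no role. -/
structure IsNonnegCDS (R : ℤ × ℤ → ℤ × ℤ → Set (ℤ × ℤ)) : Prop where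
  /-- (S1) grid path property -/
  gridPath : ∀ p q, NonnegSlope p q → IsGridPath (R p q) p q
  /-- (S2) symmetry property -/
  symmetry : ∀ p q, NonnegSlope p q → R p q = R q p
  /-- (S3) subsegment property -/
  subsegment : ∀ p q, NonnegSlope p q → ∀ r ∈ R p q, ∀ s ∈ R p q, NonnegSlope r s →
    R r s ⊆ R p q
  /-- (S4) prolongation property -/
  prolongation : ∀ p q, NonnegSlope p q → ∃ r, NonnegSlope p r ∧ r ∉ R p q ∧ R p q ⊆ R p r
  /-- (S5) monotonicity property -/
  monotonicity : ∀ p q,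
    (p.1 = q.1 → ∀ r ∈ R p q, r.1 = p.1) ∧ (p.2 = q.2 → ∀ r ∈ R p q, r.2 = p.2)

/-- The interval `I(p,q) = [p^x + p^y, q^x + q^y - 1]`, in the natural order of `ℤ`. -/
def segInterval (p q : ℤ × ℤ) : Set ℤ := Set.Icc (p.1 + p.2) (q.1 + q.2 - 1)

/-- The integer `a` is among the `q^y - p^y` greatest elements of `I(p,q)` according to `prec`. -/
def MovesUp (prec : ℤ → ℤ → Prop) (p q : ℤ × ℤ) (a : ℤ) : Prop :=
  a ∈ segInterval p q ∧ (({c ∈ segInterval p q | prec a c}.ncard : ℕ) : ℤ) < q.2 - p.2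

open Classical in
/-- The point reached after `n` steps of the walk from `p` towards `q` that is generated by the
total order `prec`. -/
noncomputable def walkPoint (prec : ℤ → ℤ → Prop) (p q : ℤ × ℤ) : ℕ → ℤ × ℤ
  | 0 => p
  | n + 1 =>
    let r := walkPoint prec p q n
    if MovesUp prec p q (r.1 + r.2) then (r.1, r.2 + 1) else (r.1 + 1, r.2)

/-- The points of the first-quadrant segment from `p` to `q` generated by `prec`; the walk has
`(q^x - p^x) + (q^y - p^y)` steps. -/
def generatedSegment (prec : ℤ → ℤ → Prop) (p q : ℤ × ℤ) : Set (ℤ × ℤ) :=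
  {r | ∃ n : ℕ, (n : ℤ) ≤ (q.1 - p.1) + (q.2 - p.2) ∧ walkPoint prec p q n = r}

/-- The column of the integer `a` in the layout view, in the row that lists the interval
`[p^x + p^y, C]` sorted by `prec`. The row of `p` starts in column `p^x`, so that the rows of two
points are shifted against each other by the difference of the `x`-coordinates. -/
noncomputable def layoutColumn (prec : ℤ → ℤ → Prop) (p : ℤ × ℤ) (C a : ℤ) : ℤ :=
  p.1 + (({c ∈ Set.Icc (p.1 + p.2) C | prec c a}.ncard : ℕ) : ℤ)

/-- The orders `prec₁` of `p₁` and `prec₂` of `p₂` have a bad pair: for some `C`, some integers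
`a`, `b` lying in both intervals, and some vertical dividing line (between the columns `l - 1` and
`l`), `a` is left and `b` is right of the line in the row of `p₁`, while `b` is left and `a` is
right of the line in the row of `p₂`. -/
def HaveBadPair (prec₁ prec₂ : ℤ → ℤ → Prop) (p₁ p₂ : ℤ × ℤ) : Prop :=
  ∃ C : ℤ, p₁.1 + p₁.2 ≤ C ∧ p₂.1 + p₂.2 ≤ C ∧
    ∃ a ∈ Set.Icc (p₁.1 + p₁.2) C ∩ Set.Icc (p₂.1 + p₂.2) C,
    ∃ b ∈ Set.Icc (p₁.1 + p₁.2) C ∩ Set.Icc (p₂.1 + p₂.2) C,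
    ∃ l : ℤ,
      layoutColumn prec₁ p₁ C a < l ∧ l ≤ layoutColumn prec₁ p₁ C b ∧
      layoutColumn prec₂ p₂ C b < l ∧ l ≤ layoutColumn prec₂ p₂ C a

/-! A segment of nonnegative slope is a monotone lattice path, hence encoded by the set of diagonals
x + y = c on which it steps up; the size of that set is the height difference of the ends. In these
terms a bad pair consists of two diagonals on which the segments from p₁ and p₂ to some common end q
disagree, in opposite directions (`haveBadPair_iff`).

From orders to segments: the up steps of a generated segment are an upper set for the order of its
start, so prefixes are automatically consistent. The tail of a segment from an intermediate point r
has the same ends, hence the same number of up steps, as the segment generated at r; if they differ,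
they differ in both directions, which is a bad pair (`suffix_subset_of_generated`). The same count
gives backward prolongation.

From segments to orders: if two segments to a common end stepped apart, some point between them
could not be prolonged backwards, against (S4) (`not_diverge_left`); `not_diverge_right` is the
mirror statement for a common start. By (S3), segments that meet stay together up to the shared end,
so they do not cross. Opposite steps therefore only bring paths closer, and this excludes bad pairs
(`not_opposite_pair`). For a fixed start, moving the end to the right along a diagonal shrinks the
set of up steps (`upSteps_anti`), by one element at a time. The sequence in which diagonals drop out
of these nested sets is the order `inducedOrder`. -/

/-- `S` is the set of points of a monotone lattice path from `p` to `q`. -/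
structure IsStair (S : Set (ℤ × ℤ)) (p q : ℤ × ℤ) : Prop where
  left_mem : p ∈ S
  right_mem : q ∈ S
  left_le : ∀ r ∈ S, p.1 ≤ r.1 ∧ p.2 ≤ r.2
  le_right : ∀ r ∈ S, r.1 ≤ q.1 ∧ r.2 ≤ q.2
  chain : ∀ r ∈ S, ∀ s ∈ S, (r.1 ≤ s.1 ∧ r.2 ≤ s.2) ∨ (s.1 ≤ r.1 ∧ s.2 ≤ r.2)
  step : ∀ r ∈ S, r ≠ q → (r.1, r.2 + 1) ∈ S ∨ (r.1 + 1, r.2) ∈ S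

/-- The diagonals on which the lattice path `S` makes a step up. -/
def upSteps (S : Set (ℤ × ℤ)) : Set ℤ := {c | ∃ r ∈ S, r.1 + r.2 = c ∧ (r.1, r.2 + 1) ∈ S}

/-! ### Monotone lattice paths and their up steps -/

namespace IsStair

variable {S T : Set (ℤ × ℤ)} {p q r s p' : ℤ × ℤ}

theorem eq_of_sum (h : IsStair S p q) (hr : r ∈ S) (hs : s ∈ S) (e : r.1 + r.2 = s.1 + s.2) :
    r = s := by
  have := h.chain r hr s hs
  ext <;> omega

theorem le_of_sum (h : IsStair S p q) (hr : r ∈ S) (hs : s ∈ S) (e : r.1 + r.2 ≤ s.1 + s.2) :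
    r.1 ≤ s.1 ∧ r.2 ≤ s.2 := by
  have := h.chain r hr s hs
  omega

theorem le (h : IsStair S p q) : p.1 ≤ q.1 ∧ p.2 ≤ q.2 := h.le_right p h.left_mem

theorem step_of_sum (h : IsStair S p q) (hr : r ∈ S) (e : r.1 + r.2 < q.1 + q.2) :
    (r.1, r.2 + 1) ∈ S ∨ (r.1 + 1, r.2) ∈ S :=
  h.step r hr (by rintro rfl; omega)

theorem exists_sum (h : IsStair S p q) {c : ℤ} (h1 : p.1 + p.2 ≤ c) (h2 : c ≤ q.1 + q.2) :
    ∃ r ∈ S, r.1 + r.2 = c := by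
  induction c, h1 using Int.leInduction with
  | base => exact ⟨p, h.left_mem, rfl⟩
  | succ c hc ih =>
    obtain ⟨r, hr, e⟩ := ih (by omega)
    rcases h.step_of_sum hr (by omega) with h' | h'
    · exact ⟨_, h', by simp only; omega⟩
    · exact ⟨_, h', by simp only; omega⟩

theorem step_back (h : IsStair S p q) (hr : r ∈ S) (e : p.1 + p.2 < r.1 + r.2) :
    (r.1, r.2 - 1) ∈ S ∨ (r.1 - 1, r.2) ∈ S := by
  have hq := h.le_right r hr
  obtain ⟨t, ht, et⟩ := h.exists_sum (c := r.1 + r.2 - 1) (by omega) (by omega)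
  rcases h.step_of_sum ht (by omega) with h' | h'
  · have := h.eq_of_sum hr h' (by simp only; omega)
    subst this
    left; simpa using ht
  · have := h.eq_of_sum hr h' (by simp only; omega)
    subst this
    right; simpa using ht

theorem mem_upSteps (h : IsStair S p q) (hr : r ∈ S) :
    r.1 + r.2 ∈ upSteps S ↔ (r.1, r.2 + 1) ∈ S := by
  constructor
  · rintro ⟨t, ht, e, h'⟩
    rwa [h.eq_of_sum hr ht e.symm]
  · exact fun h' => ⟨r, hr, rfl, h'⟩

theorem not_up_of_right (h : IsStair S p q) (h' : (r.1 + 1, r.2) ∈ S) : (r.1, r.2 + 1) ∉ S := by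
  intro h''
  have := h.eq_of_sum h' h'' (by simp only; omega)
  simp at this

theorem right_of_notMem (h : IsStair S p q) (hr : r ∈ S) (e : r.1 + r.2 < q.1 + q.2)
    (h' : r.1 + r.2 ∉ upSteps S) : (r.1 + 1, r.2) ∈ S := by
  rw [h.mem_upSteps hr] at h'
  exact (h.step_of_sum hr e).resolve_left h'

/-- The two starts may differ, so that a path can be compared with the tail of a longer one from a
common point `r` on. -/
theorem subset_of_upSteps (hS : IsStair S p q) (hT : IsStair T p' q) (hp : r ∈ S) (hp' : r ∈ T)
    (h : ∀ c, r.1 + r.2 ≤ c → c < q.1 + q.2 → (c ∈ upSteps S ↔ c ∈ upSteps T)) :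
    ∀ s ∈ S, r.1 + r.2 ≤ s.1 + s.2 → s ∈ T := by
  intro s hs hrs
  obtain ⟨c, hc⟩ : ∃ c, s.1 + s.2 = c := ⟨_, rfl⟩
  rw [hc] at hrs
  induction c, hrs using Int.leInduction generalizing s with
  | base => rwa [hS.eq_of_sum hs hp hc]
  | succ c hrc ih =>
    have h1 := hS.left_le r hp
    have h2 := hS.le_right s hs
    obtain ⟨t, ht, et⟩ := hS.exists_sum (c := c) (by omega) (by omega)
    have htT := ih t ht et
    by_cases hu : t.1 + t.2 ∈ upSteps S
    · have h3 := (hS.mem_upSteps ht).1 hu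
      rw [h _ (by omega) (by omega), hT.mem_upSteps htT] at hu
      rwa [hS.eq_of_sum hs h3 (by simp only; omega)]
    · have h3 := hS.right_of_notMem ht (by omega) hu
      rw [h _ (by omega) (by omega)] at hu
      rw [hS.eq_of_sum hs h3 (by simp only; omega)]
      exact hT.right_of_notMem htT (by omega) hu

/-- A lattice path is determined by its ends and its up steps. -/
theorem eq_of_upSteps (hS : IsStair S p q) (hT : IsStair T p q)
    (h : ∀ c, p.1 + p.2 ≤ c → c < q.1 + q.2 → (c ∈ upSteps S ↔ c ∈ upSteps T)) : S = T := by
  ext s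
  refine ⟨fun hs => ?_, fun hs => ?_⟩
  · have := hS.left_le s hs
    exact hS.subset_of_upSteps hT hS.left_mem hT.left_mem h s hs (by omega)
  · have := hT.left_le s hs
    exact hT.subset_of_upSteps hS hT.left_mem hS.left_mem
      (fun c h1 h2 => (h c h1 h2).symm) s hs (by omega)

-- Only up steps change the height, each by one. This makes the number of up steps in a window of
-- diagonals depend only on the two points reached, which drives all counting arguments below.
open Classical in
theorem card_upSteps (h : IsStair S p q) (hr : r ∈ S) (hs : s ∈ S)
    (hrs : r.1 + r.2 ≤ s.1 + s.2) :
    (((Finset.Ico (r.1 + r.2) (s.1 + s.2)).filter (· ∈ upSteps S)).card : ℤ) = s.2 - r.2 := by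
  obtain ⟨c, hc⟩ : ∃ c, s.1 + s.2 = c := ⟨_, rfl⟩
  rw [hc] at hrs ⊢
  induction c, hrs using Int.leInduction generalizing s with
  | base => simp [h.eq_of_sum hs hr hc]
  | succ c hrc ih =>
    have h1 := h.left_le r hr
    have h2 := h.le_right s hs
    obtain ⟨t, ht, et⟩ := h.exists_sum (c := c) (by omega) (by omega)
    have e : Finset.Ico (r.1 + r.2) (c + 1) = insert c (Finset.Ico (r.1 + r.2) c) := by
      ext x; simp only [Finset.mem_Ico, Finset.mem_insert]; omega
    rw [e, Finset.filter_insert]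
    by_cases hu : t.1 + t.2 ∈ upSteps S
    · have h3 := (h.mem_upSteps ht).1 hu
      rw [et] at hu
      rw [if_pos hu, Finset.card_insert_of_notMem (by simp), Nat.cast_add, ih ht et,
        h.eq_of_sum hs h3 (by simp only; omega)]
      push_cast; ring
    · have h3 := h.right_of_notMem ht (by omega) hu
      rw [et] at hu
      rw [if_neg hu, ih ht et, h.eq_of_sum hs h3 (by simp only; omega)]

theorem sub (h : IsStair S p q) (hr : r ∈ S) (hs : s ∈ S) (hrs : r.1 + r.2 ≤ s.1 + s.2) :
    IsStair {t ∈ S | r.1 + r.2 ≤ t.1 + t.2 ∧ t.1 + t.2 ≤ s.1 + s.2} r s where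
  left_mem := ⟨hr, le_rfl, hrs⟩
  right_mem := ⟨hs, hrs, le_rfl⟩
  left_le t ht := h.le_of_sum hr ht.1 ht.2.1
  le_right t ht := h.le_of_sum ht.1 hs ht.2.2
  chain t ht u hu := h.chain t ht.1 u hu.1
  step t ht hts := by
    have h1 : t.1 + t.2 ≠ s.1 + s.2 := fun e => hts (h.eq_of_sum ht.1 hs e)
    have h2 := h.le_right s hs
    obtain ⟨h3, h4, h5⟩ := ht
    rcases h.step_of_sum h3 (by omega) with h' | h'
    · exact Or.inl ⟨h', by simp only; omega, by simp only; omega⟩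
    · exact Or.inr ⟨h', by simp only; omega, by simp only; omega⟩

theorem mem_upSteps_sub {c : ℤ} (hc : r.1 + r.2 ≤ c ∧ c < s.1 + s.2) :
    c ∈ upSteps {t ∈ S | r.1 + r.2 ≤ t.1 + t.2 ∧ t.1 + t.2 ≤ s.1 + s.2} ↔ c ∈ upSteps S := by
  constructor
  · rintro ⟨t, ht, e, h'⟩
    exact ⟨t, ht.1, e, h'.1⟩
  · rintro ⟨t, ht, e, h'⟩
    exact ⟨t, ⟨ht, by omega, by omega⟩, e, h', by simp only; omega, by simp only; omega⟩

theorem eq_of_subset (hS : IsStair S p q) (hT : IsStair T p q) (h : S ⊆ T) : S = T := by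
  refine h.antisymm fun t ht => ?_
  have h1 := hT.left_le t ht
  have h2 := hT.le_right t ht
  obtain ⟨s, hs, e⟩ := hS.exists_sum (c := t.1 + t.2) (by omega) (by omega)
  rwa [hT.eq_of_sum ht (h hs) e.symm]

/-- The walk is built backwards from `q`, one diagonal at a time. The last clause records that
points on successive diagonals are consecutive on it, which is what makes the path induced. -/
theorem exists_walk (h : IsStair S p q) (n : ℕ) : ∀ r ∈ S, q.1 + q.2 - (r.1 + r.2) = n →
    ∃ w : gridGraph.Walk r q, w.IsPath ∧
      {v | v ∈ w.support} = {t ∈ S | r.1 + r.2 ≤ t.1 + t.2} ∧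
      ∀ u ∈ S, ∀ v ∈ S, r.1 + r.2 ≤ u.1 + u.2 → v.1 + v.2 = u.1 + u.2 + 1 →
        s(u, v) ∈ w.edges := by
  induction n with
  | zero =>
    intro r hr e
    obtain rfl : r = q := h.eq_of_sum hr h.right_mem (by push_cast at e; omega)
    refine ⟨.nil, .nil, ?_, ?_⟩
    · ext t
      simp only [SimpleGraph.Walk.support_nil, List.mem_singleton, Set.mem_ofPred_eq]
      constructor
      · rintro rfl; exact ⟨hr, le_rfl⟩
      · rintro ⟨ht, h1⟩
        have := h.le_right t ht
        exact h.eq_of_sum ht hr (by omega)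
    · intro u hu v hv h1 h2
      have := h.le_right v hv
      omega
  | succ n ih =>
    intro r hr e
    obtain ⟨t, ht, hadj, et⟩ : ∃ t ∈ S, gridGraph.Adj r t ∧ t.1 + t.2 = r.1 + r.2 + 1 := by
      rcases h.step_of_sum hr (by push_cast at e; omega) with h' | h'
      · exact ⟨_, h', by simp [gridGraph], by simp only; omega⟩
      · exact ⟨_, h', by simp [gridGraph], by simp only; omega⟩
    obtain ⟨w, hw, hsupp, hedge⟩ := ih t ht (by push_cast at e; omega)
    have hmem (v) : v ∈ w.support ↔ v ∈ S ∧ t.1 + t.2 ≤ v.1 + v.2 := Set.ext_iff.1 hsupp v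
    refine ⟨.cons hadj w, hw.cons ?_, ?_, ?_⟩
    · rw [hmem]; omega
    · ext v
      simp only [SimpleGraph.Walk.support_cons, List.mem_cons, Set.mem_ofPred_eq, hmem]
      constructor
      · rintro (rfl | ⟨h1, h2⟩)
        · exact ⟨hr, le_rfl⟩
        · exact ⟨h1, by omega⟩
      · rintro ⟨h1, h2⟩
        by_cases h3 : v.1 + v.2 = r.1 + r.2
        · exact Or.inl (h.eq_of_sum h1 hr h3)
        · exact Or.inr ⟨h1, by omega⟩
    · intro u hu v hv h1 h2
      rw [SimpleGraph.Walk.edges_cons, List.mem_cons]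
      by_cases h3 : u.1 + u.2 = r.1 + r.2
      · left
        rw [h.eq_of_sum hu hr h3, h.eq_of_sum hv ht (by omega)]
      · exact Or.inr (hedge u hu v hv (by omega) h2)

theorem isGridPath (h : IsStair S p q) : IsGridPath S p q := by
  have hle := h.le
  obtain ⟨w, hw, hsupp, hedge⟩ :=
    h.exists_walk (q.1 + q.2 - (p.1 + p.2)).toNat p h.left_mem (by omega)
  refine ⟨w, hw, ?_, ?_⟩
  · rw [hsupp]
    ext t
    simp only [Set.mem_ofPred_eq, and_iff_left_iff_imp]
    intro ht
    have := h.left_le t ht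
    omega
  · intro u hu v hv huv
    have h1 := h.left_le u hu
    have h2 := h.left_le v hv
    have h3 := h.chain u hu v hv
    change |u.1 - v.1| + |u.2 - v.2| = 1 at huv
    -- Comparable grid neighbours lie on adjacent diagonals.
    have h4 : v.1 + v.2 = u.1 + u.2 + 1 ∨ u.1 + u.2 = v.1 + v.2 + 1 := by
      rcases h3 with h3 | h3
      · rw [abs_of_nonpos (by omega), abs_of_nonpos (by omega)] at huv; omega
      · rw [abs_of_nonneg (by omega), abs_of_nonneg (by omega)] at huv; omega
    rcases h4 with h4 | h4
    · exact hedge u hu v hv (by omega) h4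
    · rw [Sym2.eq_swap]
      exact hedge v hv u hu (by omega) h4

end IsStair

theorem IsGridPath.symm {S : Set (ℤ × ℤ)} {p q : ℤ × ℤ} (h : IsGridPath S p q) :
    IsGridPath S q p := by
  obtain ⟨w, hw, hsupp, hedge⟩ := h
  exact ⟨w.reverse, hw.reverse, by simpa using hsupp, by simpa using hedge⟩

/-! ### Segments of a CDS are monotone lattice paths -/

/-- A discrete intermediate value theorem: only upward jumps need to be bounded. -/
theorem exists_eq_of_small_steps (f : ℕ → ℤ) {i j : ℕ} (hij : i ≤ j)
    (hf : ∀ k, i ≤ k → k < j → f (k + 1) ≤ f k + 1) {c : ℤ} (h1 : f i ≤ c) (h2 : c ≤ f j) :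
    ∃ k, i ≤ k ∧ k ≤ j ∧ f k = c := by
  induction j, hij using Nat.le_induction with
  | base => exact ⟨i, le_rfl, le_rfl, by omega⟩
  | succ j hij ih =>
    by_cases h : c ≤ f j
    · obtain ⟨k, hk⟩ := ih (fun k h3 h4 => hf k h3 (by omega)) h
      exact ⟨k, hk.1, by omega, hk.2.2⟩
    · have := hf j hij (by omega)
      exact ⟨j + 1, by omega, le_rfl, by omega⟩

/-- If `x` drops by one at `k`, the intermediate value theorem finds either the lower value `x (k +
1)` at some index before the drop or the upper value `x k` at some index after it. Constancy between
equal values then contradicts the drop. -/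
theorem le_succ_of_const_between (x : ℕ → ℤ) {n : ℕ}
    (hx : ∀ k < n, x (k + 1) ≤ x k + 1 ∧ x k ≤ x (k + 1) + 1)
    (hc : ∀ i k j, i ≤ k → k ≤ j → j ≤ n → x i = x j → x k = x i) (h0 : x 0 ≤ x n) :
    ∀ k < n, x k ≤ x (k + 1) := by
  intro k hk
  by_contra! hlt
  have hk' := hx k hk
  by_cases h : x 0 ≤ x (k + 1)
  · obtain ⟨i, -, hi, e⟩ := exists_eq_of_small_steps x (Nat.zero_le k)
      (fun m _ hm => (hx m (by omega)).1) h hlt.le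
    have := hc i k (k + 1) hi (by omega) (by omega) e
    omega
  · obtain ⟨j, hj, hjn, e⟩ := exists_eq_of_small_steps x (c := x k) (show k + 1 ≤ n from hk)
      (fun m _ hm => (hx m (by omega)).1) hlt.le (by omega)
    have := hc k (k + 1) j (by omega) hj hjn e.symm
    omega

namespace IsNonnegCDS

variable {R : ℤ × ℤ → ℤ × ℤ → Set (ℤ × ℤ)}

/-- The subsegment has its own path inside `R p q`. As grid neighbours in `R p q` are consecutive on
`w`, each step of that path changes the index along `w` by one; running from `i` to `j`, the index
passes through `k`. -/
theorem getVert_mem (hR : IsNonnegCDS R) {p q : ℤ × ℤ} (hpq : NonnegSlope p q)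
    (w : gridGraph.Walk p q) (hw : w.IsPath) (hsupp : {v | v ∈ w.support} = R p q)
    (hedge : ∀ r ∈ R p q, ∀ s ∈ R p q, gridGraph.Adj r s → s(r, s) ∈ w.edges)
    {i k j : ℕ} (hik : i ≤ k) (hkj : k ≤ j) (hj : j ≤ w.length)
    (hij : NonnegSlope (w.getVert i) (w.getVert j)) :
    w.getVert k ∈ R (w.getVert i) (w.getVert j) := by
  have hmem (m : ℕ) : w.getVert m ∈ R p q := by
    rw [← hsupp]; exact w.getVert_mem_support m
  have hsub := hR.subsegment p q hpq _ (hmem i) _ (hmem j) hij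
  obtain ⟨w', -, hsupp', -⟩ := hR.gridPath _ _ hij
  have hmem' (m : ℕ) : w'.getVert m ∈ R (w.getVert i) (w.getVert j) := by
    rw [← hsupp']; exact w'.getVert_mem_support m
  have hidx (m : ℕ) : ∃ n, w.getVert n = w'.getVert m ∧ n ≤ w.length := by
    have := hsub (hmem' m)
    rw [← hsupp] at this
    exact SimpleGraph.Walk.mem_support_iff_exists_getVert.1 this
  choose f hf hfle using hidx
  have f0 : f 0 = i := hw.getVert_injOn (hfle 0) (show i ≤ w.length by omega) (by rw [hf]; simp)
  have fn : f w'.length = j := hw.getVert_injOn (hfle _) hj (by rw [hf]; simp)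
  obtain ⟨m, -, -, hm⟩ := exists_eq_of_small_steps (fun m => (f m : ℤ)) (Nat.zero_le w'.length)
    (c := k) (fun m _ hm => by
      have hadj := w'.adj_getVert_succ hm
      have := hedge _ (hsub (hmem' m)) _ (hsub (hmem' (m + 1))) hadj
      rw [← SimpleGraph.Walk.adj_toSubgraph_iff_mem_edges, SimpleGraph.Walk.toSubgraph_adj_iff,
        ← hf, ← hf] at this
      obtain ⟨n, hn, hnlt⟩ := this
      rw [Sym2.eq_iff] at hn
      have key {a b : ℕ} (ha : a ≤ w.length) (hb : b ≤ w.length)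
          (e : w.getVert a = w.getVert b) : a = b := hw.getVert_injOn ha hb e
      rcases hn with ⟨e1, e2⟩ | ⟨e1, e2⟩
      · have e1 := key hnlt.le (hfle _) e1
        have e2 := key hnlt (hfle _) e2
        omega
      · have e1 := key hnlt.le (hfle _) e1
        have e2 := key hnlt (hfle _) e2
        omega) (by simp only [f0]; omega) (by simp only [fn]; omega)
  have hm : f m = k := by exact_mod_cast hm
  rw [← hm, hf]
  exact hmem' m

/-- Two path vertices with equal x-coordinate form a pair of nonnegative slope, so (S5) keeps x
constant on the stretch of path between them, and x cannot decrease anywhere. The same holds for y.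
-/
theorem isStair (hR : IsNonnegCDS R) {p q : ℤ × ℤ} (h1 : p.1 ≤ q.1) (h2 : p.2 ≤ q.2) :
    IsStair (R p q) p q := by
  have hpq : NonnegSlope p q := Or.inl ⟨h1, h2⟩
  obtain ⟨w, hw, hsupp, hedge⟩ := hR.gridPath p q hpq
  have hadj (k : ℕ) (hk : k < w.length) : |(w.getVert k).1 - (w.getVert (k + 1)).1| +
      |(w.getVert k).2 - (w.getVert (k + 1)).2| = 1 := w.adj_getVert_succ hk
  have hX : ∀ k < w.length, (w.getVert k).1 ≤ (w.getVert (k + 1)).1 := by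
    refine le_succ_of_const_between (fun k => (w.getVert k).1) (fun k hk => ?_) ?_ (by simpa)
    · have := hadj k hk
      grind
    · intro i k j hik hkj hj e
      have hij : NonnegSlope (w.getVert i) (w.getVert j) := by
        rcases le_total (w.getVert i).2 (w.getVert j).2 with h | h
        · exact Or.inl ⟨e.le, h⟩
        · exact Or.inr ⟨e.ge, h⟩
      exact (hR.monotonicity _ _).1 e _ (hR.getVert_mem hpq w hw hsupp hedge hik hkj hj hij)
  have hY : ∀ k < w.length, (w.getVert k).2 ≤ (w.getVert (k + 1)).2 := by
    refine le_succ_of_const_between (fun k => (w.getVert k).2) (fun k hk => ?_) ?_ (by simpa)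
    · have := hadj k hk
      grind
    · intro i k j hik hkj hj e
      have hij : NonnegSlope (w.getVert i) (w.getVert j) := by
        rcases le_total (w.getVert i).1 (w.getVert j).1 with h | h
        · exact Or.inl ⟨h, e.le⟩
        · exact Or.inr ⟨h, e.ge⟩
      exact (hR.monotonicity _ _).2 e _ (hR.getVert_mem hpq w hw hsupp hedge hik hkj hj hij)
  have hmono (i j : ℕ) (hij : i ≤ j) (hj : j ≤ w.length) :
      (w.getVert i).1 ≤ (w.getVert j).1 ∧ (w.getVert i).2 ≤ (w.getVert j).2 := by
    induction j, hij using Nat.le_induction with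
    | base => simp
    | succ j hij ih =>
      have := ih (by omega)
      have := hX j hj
      have := hY j hj
      omega
  have hmem (m : ℕ) : w.getVert m ∈ R p q := by
    rw [← hsupp]; exact w.getVert_mem_support m
  have hidx (r) (hr : r ∈ R p q) : ∃ n, w.getVert n = r ∧ n ≤ w.length := by
    rw [← hsupp] at hr
    exact SimpleGraph.Walk.mem_support_iff_exists_getVert.1 hr
  refine ⟨by simpa using hmem 0, by simpa using hmem w.length, ?_, ?_, ?_, ?_⟩
  · intro r hr
    obtain ⟨n, rfl, hn⟩ := hidx r hr
    simpa using hmono 0 n (Nat.zero_le n) hn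
  · intro r hr
    obtain ⟨n, rfl, hn⟩ := hidx r hr
    simpa using hmono n w.length hn le_rfl
  · intro r hr s hs
    obtain ⟨n, rfl, hn⟩ := hidx r hr
    obtain ⟨m, rfl, hm⟩ := hidx s hs
    rcases le_total n m with h | h
    · exact Or.inl (hmono n m h hm)
    · exact Or.inr (hmono m n h hn)
  · intro r hr hrq
    obtain ⟨n, rfl, hn⟩ := hidx r hr
    have hlt : n < w.length := by
      refine lt_of_le_of_ne hn ?_
      rintro rfl
      simp at hrq
    have h3 := hadj n hlt
    have h4 := hX n hlt
    have h5 := hY n hlt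
    have h6 := hmem (n + 1)
    rw [abs_of_nonpos (by omega), abs_of_nonpos (by omega)] at h3
    obtain e | e : w.getVert (n + 1) = ((w.getVert n).1, (w.getVert n).2 + 1) ∨
        w.getVert (n + 1) = ((w.getVert n).1 + 1, (w.getVert n).2) := by
      by_cases h7 : (w.getVert n).1 = (w.getVert (n + 1)).1
      · left; ext
        · exact h7.symm
        · simp only; omega
      · right; ext <;> simp only <;> omega
    · rw [e] at h6; exact Or.inl h6
    · rw [e] at h6; exact Or.inr h6

/-- (S3) gives one inclusion; it is an equality because lattice paths with the same ends have one
point on each diagonal. -/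
theorem seg_eq (hR : IsNonnegCDS R) {p q r s : ℤ × ℤ} (h1 : p.1 ≤ q.1) (h2 : p.2 ≤ q.2)
    (hr : r ∈ R p q) (hs : s ∈ R p q) (h : r.1 + r.2 ≤ s.1 + s.2) :
    R r s = {t ∈ R p q | r.1 + r.2 ≤ t.1 + t.2 ∧ t.1 + t.2 ≤ s.1 + s.2} := by
  have hS := hR.isStair h1 h2
  have hrs := hS.le_of_sum hr hs h
  have hT := hR.isStair hrs.1 hrs.2
  refine hT.eq_of_subset (hS.sub hr hs h) fun t ht => ?_
  have h3 := hT.left_le t ht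
  have h4 := hT.le_right t ht
  exact ⟨hR.subsegment p q (Or.inl ⟨h1, h2⟩) r hr s hs (Or.inl hrs) ht, by omega, by omega⟩

/-- The prolongation from (S4) may be long; cutting it one step after `q` leaves a prolongation by a
single step. -/
theorem exists_extend_right (hR : IsNonnegCDS R) {p q : ℤ × ℤ} (h1 : p.1 ≤ q.1)
    (h2 : p.2 ≤ q.2) : ∃ r, r.1 + r.2 = q.1 + q.2 + 1 ∧ q.1 ≤ r.1 ∧ q.2 ≤ r.2 ∧ q ∈ R p r := by
  obtain ⟨r, hpr, hr, hsub⟩ := hR.prolongation p q (Or.inl ⟨h1, h2⟩)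
  have hq := (hR.isStair h1 h2).right_mem
  rcases hpr with hpr | hpr
  · have hS := hR.isStair hpr.1 hpr.2
    have hqr : q ≠ r := by rintro rfl; exact hr hq
    rcases hS.step q (hsub hq) hqr with h | h
    · refine ⟨(q.1, q.2 + 1), by simp only; omega, le_rfl, by simp only; omega, ?_⟩
      rw [hR.seg_eq hpr.1 hpr.2 hS.left_mem h (by simp only; omega)]
      exact ⟨hsub hq, by omega, by simp only; omega⟩
    · refine ⟨(q.1 + 1, q.2), by simp only; omega, by simp only; omega, le_rfl, ?_⟩
      rw [hR.seg_eq hpr.1 hpr.2 hS.left_mem h (by simp only; omega)]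
      exact ⟨hsub hq, by omega, by simp only; omega⟩
  -- A prolongation into the third quadrant of `p` is possible only for `p = q`, and then any
  -- one-step extension works.
  · have h3 := hsub hq
    rw [hR.symmetry p r (Or.inr hpr)] at h3
    have h4 := (hR.isStair hpr.1 hpr.2).le_right q h3
    obtain rfl : p = q := by ext <;> omega
    exact ⟨(p.1 + 1, p.2), by simp only; omega, by simp only; omega, le_rfl,
      (hR.isStair (p := p) (q := (p.1 + 1, p.2)) (by simp only; omega) le_rfl).left_mem⟩

theorem exists_extend_left (hR : IsNonnegCDS R) {p q : ℤ × ℤ} (h1 : p.1 ≤ q.1)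
    (h2 : p.2 ≤ q.2) : p ∈ R (p.1, p.2 - 1) q ∨ p ∈ R (p.1 - 1, p.2) q := by
  have hqp : NonnegSlope q p := Or.inr ⟨h1, h2⟩
  obtain ⟨r, hqr, hr, hsub⟩ := hR.prolongation q p hqp
  rw [hR.symmetry q p hqp] at hr hsub
  have hp := (hR.isStair h1 h2).left_mem
  rcases hqr with hqr | hqr
  · have h4 := (hR.isStair hqr.1 hqr.2).left_le p (hsub hp)
    obtain rfl : p = q := by ext <;> omega
    exact Or.inl (hR.isStair (p := (p.1, p.2 - 1)) (q := p) le_rfl (by simp only; omega)).right_mem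
  · rw [hR.symmetry q r (Or.inr hqr)] at hsub
    have hS := hR.isStair hqr.1 hqr.2
    have hle := hS.left_le p (hsub hp)
    have hlt : r.1 + r.2 < p.1 + p.2 := by
      rcases lt_or_eq_of_le (show r.1 + r.2 ≤ p.1 + p.2 by omega) with h | h
      · exact h
      · exact absurd (hS.eq_of_sum hS.left_mem (hsub hp) h ▸ hp) hr
    rcases hS.step_back (hsub hp) hlt with h | h
    · left
      rw [hR.seg_eq hqr.1 hqr.2 h hS.right_mem (by simp only; omega)]
      exact ⟨hsub hp, by simp only; omega, by omega⟩
    · right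
      rw [hR.seg_eq hqr.1 hqr.2 h hS.right_mem (by simp only; omega)]
      exact ⟨hsub hp, by simp only; omega, by omega⟩

end IsNonnegCDS

/-! ### Segments generated by a total order -/

open Classical in
theorem ncard_sep_segInterval (P : ℤ → Prop) (p q : ℤ × ℤ) :
    {c ∈ segInterval p q | P c}.ncard =
      ((Finset.Ico (p.1 + p.2) (q.1 + q.2)).filter P).card := by
  rw [← Set.ncard_coe_finset]
  congr 1
  ext c
  simp only [segInterval, Set.mem_ofPred_eq, Set.mem_Icc, Finset.coe_filter, Finset.mem_Ico]
  constructor <;> rintro ⟨h1, h2⟩ <;> exact ⟨by omega, h2⟩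

theorem mem_segInterval {p q : ℤ × ℤ} {a : ℤ} :
    a ∈ segInterval p q ↔ p.1 + p.2 ≤ a ∧ a < q.1 + q.2 := by
  simp only [segInterval, Set.mem_Icc]
  omega

section Walk

variable {prec : ℤ → ℤ → Prop}

theorem walkPoint_succ_of_movesUp {p q : ℤ × ℤ} {n : ℕ}
    (h : MovesUp prec p q ((walkPoint prec p q n).1 + (walkPoint prec p q n).2)) :
    walkPoint prec p q (n + 1) = ((walkPoint prec p q n).1, (walkPoint prec p q n).2 + 1) := by
  simp [walkPoint, h]

theorem walkPoint_succ_of_not_movesUp {p q : ℤ × ℤ} {n : ℕ}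
    (h : ¬ MovesUp prec p q ((walkPoint prec p q n).1 + (walkPoint prec p q n).2)) :
    walkPoint prec p q (n + 1) = ((walkPoint prec p q n).1 + 1, (walkPoint prec p q n).2) := by
  simp [walkPoint, h]

theorem walkPoint_sum (p q : ℤ × ℤ) (n : ℕ) :
    (walkPoint prec p q n).1 + (walkPoint prec p q n).2 = p.1 + p.2 + n := by
  induction n with
  | zero => simp [walkPoint]
  | succ n ih =>
    by_cases h : MovesUp prec p q ((walkPoint prec p q n).1 + (walkPoint prec p q n).2)
    · rw [walkPoint_succ_of_movesUp h]; push_cast; omega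
    · rw [walkPoint_succ_of_not_movesUp h]; push_cast; omega

theorem walkPoint_mono (p q : ℤ × ℤ) {n m : ℕ} (hnm : n ≤ m) :
    (walkPoint prec p q n).1 ≤ (walkPoint prec p q m).1 ∧
      (walkPoint prec p q n).2 ≤ (walkPoint prec p q m).2 := by
  induction m, hnm using Nat.le_induction with
  | base => simp
  | succ m hnm ih =>
    by_cases h : MovesUp prec p q ((walkPoint prec p q m).1 + (walkPoint prec p q m).2)
    · rw [walkPoint_succ_of_movesUp h]; simp only; omega
    · rw [walkPoint_succ_of_not_movesUp h]; simp only; omega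

open Classical in
theorem walkPoint_snd (p q : ℤ × ℤ) (n : ℕ) :
    (walkPoint prec p q n).2 = p.2 +
      ((Finset.Ico (p.1 + p.2) (p.1 + p.2 + n)).filter (MovesUp prec p q)).card := by
  induction n with
  | zero => simp [walkPoint]
  | succ n ih =>
    have e : Finset.Ico (p.1 + p.2) (p.1 + p.2 + (n + 1 : ℕ)) =
        insert (p.1 + p.2 + n) (Finset.Ico (p.1 + p.2) (p.1 + p.2 + n)) := by
      ext x; simp only [Finset.mem_Ico, Finset.mem_insert]; push_cast; omega
    rw [e, Finset.filter_insert]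
    by_cases h : MovesUp prec p q ((walkPoint prec p q n).1 + (walkPoint prec p q n).2)
    · rw [walkPoint_succ_of_movesUp h]
      rw [walkPoint_sum] at h
      rw [if_pos h, Finset.card_insert_of_notMem (by simp), ih]
      push_cast; ring
    · rw [walkPoint_succ_of_not_movesUp h]
      rw [walkPoint_sum] at h
      rw [if_neg h, ih]

end Walk

section StrictTotalOrder

variable {prec : ℤ → ℤ → Prop} [IsStrictTotalOrder ℤ prec]

open Classical in
/-- In a finite set with at least `k` elements, exactly `k` elements have fewer than `k`
elements above them. -/
theorem card_filter_rank_lt (s : Finset ℤ) {k : ℕ} (hk : k ≤ s.card) :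
    (s.filter fun a => (s.filter fun c => prec a c).card < k).card = k := by
  set f : ℤ → ℕ := fun a => (s.filter fun c => prec a c).card with hf
  have hlt {a b : ℤ} (hb : b ∈ s) (hab : prec a b) : f b < f a := by
    refine Finset.card_lt_card (Finset.ssubset_iff_of_subset ?_ |>.2 ?_)
    · intro c hc
      rw [Finset.mem_filter] at hc ⊢
      exact ⟨hc.1, trans_of prec hab hc.2⟩
    · exact ⟨b, by simp [hb, hab], by simp [irrefl_of prec b]⟩
  have hinj : Set.InjOn f s := by
    intro a ha b hb hab
    rcases trichotomous_of prec a b with h | h | h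
    · exact absurd hab (hlt hb h).ne'
    · exact h
    · exact absurd hab (hlt ha h).ne
  -- The rank is injective with values below `s.card`, hence takes each such value exactly once.
  have himg : s.image f = Finset.range s.card := by
    refine Finset.eq_of_subset_of_card_le ?_ ?_
    · intro n hn
      obtain ⟨a, ha, rfl⟩ := Finset.mem_image.1 hn
      rw [Finset.mem_range]
      exact Finset.card_lt_card (Finset.filter_ssubset.2 ⟨a, ha, irrefl_of prec a⟩)
    · rw [Finset.card_image_of_injOn hinj, Finset.card_range]
  have h2 : (s.filter fun a => f a < k).image f = Finset.range k := by
    ext n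
    simp only [Finset.mem_image, Finset.mem_filter, Finset.mem_range]
    constructor
    · rintro ⟨a, ⟨-, h⟩, rfl⟩; exact h
    · intro h
      have : n ∈ s.image f := by rw [himg, Finset.mem_range]; omega
      obtain ⟨a, ha, rfl⟩ := Finset.mem_image.1 this
      exact ⟨a, ⟨ha, h⟩, rfl⟩
  rw [← Finset.card_image_of_injOn (hinj.mono (Finset.coe_subset.2 (Finset.filter_subset _ _))), h2, Finset.card_range]

-- This count makes the generated walk end at `q`.
open Classical in
theorem card_movesUp {p q : ℤ × ℤ} (h1 : p.1 ≤ q.1) (h2 : p.2 ≤ q.2) :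
    (((Finset.Ico (p.1 + p.2) (q.1 + q.2)).filter (MovesUp prec p q)).card : ℤ) = q.2 - p.2 := by
  obtain ⟨k, hk⟩ := Int.eq_ofNat_of_zero_le (show 0 ≤ q.2 - p.2 by omega)
  have := card_filter_rank_lt (prec := prec) (Finset.Ico (p.1 + p.2) (q.1 + q.2)) (k := k)
    (by rw [Int.card_Ico]; omega)
  rw [hk]
  norm_cast
  refine Eq.trans (congrArg _ (Finset.filter_congr fun a ha => ?_)) this
  rw [Finset.mem_Ico] at ha
  rw [MovesUp, mem_segInterval, ncard_sep_segInterval, hk, Nat.cast_lt]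
  exact and_iff_right ha

theorem MovesUp.of_prec {p q : ℤ × ℤ} {a b : ℤ} (ha : MovesUp prec p q a) (hab : prec a b)
    (hb : b ∈ segInterval p q) : MovesUp prec p q b := by
  refine ⟨hb, lt_of_le_of_lt ?_ ha.2⟩
  rw [Nat.cast_le]
  exact Set.ncard_le_ncard (fun c hc => ⟨hc.1, trans_of prec hab hc.2⟩)
    ((Set.finite_Icc _ _).subset fun c hc => hc.1)

theorem walkPoint_end {p q : ℤ × ℤ} (h1 : p.1 ≤ q.1) (h2 : p.2 ≤ q.2) {n : ℕ}
    (hn : (n : ℤ) = (q.1 - p.1) + (q.2 - p.2)) : walkPoint prec p q n = q := by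
  have hs := walkPoint_sum (prec := prec) p q n
  have hy := walkPoint_snd (prec := prec) p q n
  rw [show p.1 + p.2 + n = q.1 + q.2 by omega, card_movesUp h1 h2] at hy
  ext <;> omega

theorem isStair_generatedSegment {p q : ℤ × ℤ} (h1 : p.1 ≤ q.1) (h2 : p.2 ≤ q.2) :
    IsStair (generatedSegment prec p q) p q := by
  obtain ⟨N, hN⟩ := Int.eq_ofNat_of_zero_le (show 0 ≤ (q.1 - p.1) + (q.2 - p.2) by omega)
  have hend : walkPoint prec p q N = q := walkPoint_end h1 h2 hN.symm
  refine ⟨⟨0, by omega, rfl⟩, ⟨N, by omega, hend⟩, ?_, ?_, ?_, ?_⟩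
  · rintro _ ⟨n, -, rfl⟩
    exact walkPoint_mono p q (Nat.zero_le n)
  · rintro _ ⟨n, hn, rfl⟩
    have := walkPoint_mono (prec := prec) p q (show n ≤ N by omega)
    rwa [hend] at this
  · rintro _ ⟨n, -, rfl⟩ _ ⟨m, -, rfl⟩
    rcases le_total n m with h | h
    · exact Or.inl (walkPoint_mono p q h)
    · exact Or.inr (walkPoint_mono p q h)
  · rintro _ ⟨n, hn, rfl⟩ hne
    have hlt : n ≠ N := by rintro rfl; exact hne hend
    have hmem : walkPoint prec p q (n + 1) ∈ generatedSegment prec p q :=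
      ⟨n + 1, by push_cast; omega, rfl⟩
    by_cases h : MovesUp prec p q ((walkPoint prec p q n).1 + (walkPoint prec p q n).2)
    · rw [walkPoint_succ_of_movesUp h] at hmem; exact Or.inl hmem
    · rw [walkPoint_succ_of_not_movesUp h] at hmem; exact Or.inr hmem

theorem mem_upSteps_generatedSegment {p q : ℤ × ℤ} (h1 : p.1 ≤ q.1) (h2 : p.2 ≤ q.2) {c : ℤ}
    (hc : c ∈ segInterval p q) :
    c ∈ upSteps (generatedSegment prec p q) ↔ MovesUp prec p q c := by
  rw [mem_segInterval] at hc
  have hS := isStair_generatedSegment (prec := prec) h1 h2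
  obtain ⟨n, hn⟩ := Int.eq_ofNat_of_zero_le (show 0 ≤ c - (p.1 + p.2) by omega)
  have hsum := walkPoint_sum (prec := prec) p q n
  have hr : walkPoint prec p q n ∈ generatedSegment prec p q := ⟨n, by omega, rfl⟩
  have hmem : walkPoint prec p q (n + 1) ∈ generatedSegment prec p q :=
    ⟨n + 1, by push_cast; omega, rfl⟩
  obtain rfl : (walkPoint prec p q n).1 + (walkPoint prec p q n).2 = c := by omega
  rw [hS.mem_upSteps hr]
  by_cases h : MovesUp prec p q ((walkPoint prec p q n).1 + (walkPoint prec p q n).2)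
  · rw [walkPoint_succ_of_movesUp h] at hmem
    exact iff_of_true hmem h
  · rw [walkPoint_succ_of_not_movesUp h] at hmem
    exact iff_of_false (hS.not_up_of_right hmem) h

/-- If between two diagonals the path `S` makes at most as many up steps as the path `T`, then an
up step of `S` only is compensated by an up step of `T` only. -/
theorem exists_upStep_of_card_le {S T : Set (ℤ × ℤ)} {p q p' q' r s r' s' : ℤ × ℤ}
    (hS : IsStair S p q) (hT : IsStair T p' q') (hr : r ∈ S) (hs : s ∈ S) (hr' : r' ∈ T)
    (hs' : s' ∈ T) (hrs : r.1 + r.2 ≤ s.1 + s.2) (e : r'.1 + r'.2 = r.1 + r.2)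
    (e' : s'.1 + s'.2 = s.1 + s.2) (hle : s.2 - r.2 ≤ s'.2 - r'.2) {a : ℤ}
    (ha1 : r.1 + r.2 ≤ a) (ha2 : a < s.1 + s.2) (haS : a ∈ upSteps S) (haT : a ∉ upSteps T) :
    ∃ b, r.1 + r.2 ≤ b ∧ b < s.1 + s.2 ∧ b ∉ upSteps S ∧ b ∈ upSteps T := by
  classical
  have h1 := hS.card_upSteps hr hs hrs
  have h2 := hT.card_upSteps hr' hs' (by omega)
  rw [e, e'] at h2
  by_contra! hcon
  have hsub : (Finset.Ico (r.1 + r.2) (s.1 + s.2)).filter (· ∈ upSteps T) ⊆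
      (Finset.Ico (r.1 + r.2) (s.1 + s.2)).filter (· ∈ upSteps S) := by
    intro b hb
    rw [Finset.mem_filter, Finset.mem_Ico] at hb ⊢
    refine ⟨hb.1, ?_⟩
    by_contra hbS
    exact hcon b hb.1.1 hb.1.2 hbS hb.2
  -- Without such a `b` the up steps of `T` are among those of `S`, and the cardinalities force
  -- equality.
  have heq := Finset.eq_of_subset_of_card_le hsub (by omega)
  have : a ∈ (Finset.Ico (r.1 + r.2) (s.1 + s.2)).filter (· ∈ upSteps S) := by
    simp [ha1, ha2, haS]
  rw [← heq, Finset.mem_filter] at this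
  exact haT this.2

/-- A lattice path whose up steps are closed upwards is the generated segment. -/
theorem IsStair.eq_generatedSegment {S : Set (ℤ × ℤ)} {p q : ℤ × ℤ} (hS : IsStair S p q)
    (hup : ∀ a ∈ segInterval p q, ∀ b ∈ segInterval p q, a ∈ upSteps S → prec a b →
      b ∈ upSteps S) : S = generatedSegment prec p q := by
  have hle := hS.le
  have hT := isStair_generatedSegment (prec := prec) hle.1 hle.2
  have key {a b : ℤ} (ha : a ∈ segInterval p q) (hb : b ∈ segInterval p q)
      (haS : a ∈ upSteps S) (haT : a ∉ upSteps (generatedSegment prec p q))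
      (hbS : b ∉ upSteps S) (hbT : b ∈ upSteps (generatedSegment prec p q)) : False := by
    rw [mem_upSteps_generatedSegment hle.1 hle.2 ha] at haT
    rw [mem_upSteps_generatedSegment hle.1 hle.2 hb] at hbT
    rcases trichotomous_of prec a b with h | h | h
    · exact hbS (hup a ha b hb haS h)
    · exact hbS (h ▸ haS)
    · exact haT (hbT.of_prec h ha)
  refine hS.eq_of_upSteps hT fun c h1 h2 => ⟨fun hcS => ?_, fun hcT => ?_⟩
  · by_contra hcT
    obtain ⟨b, hb1, hb2, hbS, hbT⟩ := exists_upStep_of_card_le hS hT hS.left_mem hS.right_mem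
      hT.left_mem hT.right_mem (by omega) rfl rfl le_rfl h1 h2 hcS hcT
    exact key (mem_segInterval.2 ⟨h1, h2⟩) (mem_segInterval.2 ⟨hb1, hb2⟩) hcS hcT hbS hbT
  · by_contra hcS
    obtain ⟨b, hb1, hb2, hbT, hbS⟩ := exists_upStep_of_card_le hT hS hT.left_mem hT.right_mem
      hS.left_mem hS.right_mem (by omega) rfl rfl le_rfl h1 h2 hcT hcS
    exact key (mem_segInterval.2 ⟨hb1, hb2⟩) (mem_segInterval.2 ⟨h1, h2⟩) hbS hbT hcS hcT

/-- In the row of `p` for the interval ending on the last diagonal before `q`, the entries that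
generate up steps towards `q` are those in the columns from `q.1` on. -/
theorem movesUp_iff_layoutColumn {p q : ℤ × ℤ} {a : ℤ} (ha : a ∈ segInterval p q) :
    MovesUp prec p q a ↔ q.1 ≤ layoutColumn prec p (q.1 + q.2 - 1) a := by
  classical
  have hI : {c ∈ Set.Icc (p.1 + p.2) (q.1 + q.2 - 1) | prec c a} =
    {c ∈ segInterval p q | prec c a} := rfl
  rw [MovesUp, and_iff_right ha, layoutColumn, hI, ncard_sep_segInterval, ncard_sep_segInterval]
  rw [mem_segInterval] at ha
  set s := Finset.Ico (p.1 + p.2) (q.1 + q.2) with hs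
  have has : a ∈ s := by simp [hs, ha]
  -- The elements above and below `a` together number one less than the interval, which converts
  -- rank from the top into column from the left.
  have e : s.erase a = s.filter (fun c => prec a c) ∪ s.filter (fun c => prec c a) := by
    ext c
    simp only [Finset.mem_erase, Finset.mem_union, Finset.mem_filter]
    constructor
    · rintro ⟨h, hc⟩
      rcases trichotomous_of prec a c with h' | h' | h'
      · exact Or.inl ⟨hc, h'⟩
      · exact absurd h'.symm h
      · exact Or.inr ⟨hc, h'⟩
    · rintro (⟨hc, h⟩ | ⟨hc, h⟩)
      · exact ⟨by rintro rfl; exact irrefl_of prec _ h, hc⟩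
      · exact ⟨by rintro rfl; exact irrefl_of prec _ h, hc⟩
  have hcard := congrArg Finset.card e
  rw [Finset.card_erase_of_mem has, Finset.card_union_of_disjoint, hs, Int.card_Ico, ← hs] at hcard
  · change _ = (s.filter (prec a)).card + _ at hcard
    omega
  · rw [Finset.disjoint_filter]
    exact fun c _ h1 h2 => irrefl_of prec _ (trans_of prec h1 h2)

theorem layoutColumn_bounds {p : ℤ × ℤ} {C a : ℤ} (ha : a ∈ Set.Icc (p.1 + p.2) C) :
    p.1 ≤ layoutColumn prec p C a ∧ layoutColumn prec p C a ≤ C - p.2 := by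
  refine ⟨by rw [layoutColumn]; omega, ?_⟩
  have hlt : {c ∈ Set.Icc (p.1 + p.2) C | prec c a}.ncard < (Set.Icc (p.1 + p.2) C).ncard := by
    refine Set.ncard_lt_ncard ⟨fun c hc => hc.1, fun h => ?_⟩ (Set.finite_Icc _ _)
    exact irrefl_of prec _ (h ha).2
  rw [← Finset.coe_Icc, Set.ncard_coe_finset, Int.card_Icc, Finset.coe_Icc] at hlt
  rw [layoutColumn]
  omega

end StrictTotalOrder

/-- A bad pair is a pair of diagonals on which the segments generated from `p₁` and `p₂` to a
common end make opposite steps. -/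
theorem haveBadPair_iff {prec₁ prec₂ : ℤ → ℤ → Prop} [IsStrictTotalOrder ℤ prec₁]
    [IsStrictTotalOrder ℤ prec₂] {p₁ p₂ : ℤ × ℤ} :
    HaveBadPair prec₁ prec₂ p₁ p₂ ↔ ∃ q : ℤ × ℤ, (p₁.1 ≤ q.1 ∧ p₁.2 ≤ q.2) ∧
      (p₂.1 ≤ q.1 ∧ p₂.2 ≤ q.2) ∧ ∃ a b, a ∈ segInterval p₁ q ∧ a ∈ segInterval p₂ q ∧
      b ∈ segInterval p₁ q ∧ b ∈ segInterval p₂ q ∧ ¬ MovesUp prec₁ p₁ q a ∧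
      MovesUp prec₁ p₁ q b ∧ MovesUp prec₂ p₂ q a ∧ ¬ MovesUp prec₂ p₂ q b := by
  constructor
  · rintro ⟨C, -, -, a, ⟨ha1, ha2⟩, b, ⟨hb1, hb2⟩, l, h1, h2, h3, h4⟩
    have ba1 := layoutColumn_bounds (prec := prec₁) ha1
    have ba2 := layoutColumn_bounds (prec := prec₂) ha2
    have bb1 := layoutColumn_bounds (prec := prec₁) hb1
    have bb2 := layoutColumn_bounds (prec := prec₂) hb2
    -- The end lies on diagonal `C + 1`, one past the last entry of the rows, with the dividing line
    -- as its x-coordinate.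
    refine ⟨(l, C + 1 - l), ⟨by simp only; omega, by simp only; omega⟩,
      ⟨by simp only; omega, by simp only; omega⟩, a, b, ?_⟩
    have hC : (l, C + 1 - l).1 + (l, C + 1 - l).2 - 1 = C := by simp only; omega
    have hI (p : ℤ × ℤ) : segInterval p (l, C + 1 - l) = Set.Icc (p.1 + p.2) C := by
      rw [segInterval, hC]
    rw [← hI] at ha1 ha2 hb1 hb2
    rw [movesUp_iff_layoutColumn ha1, movesUp_iff_layoutColumn ha2,
      movesUp_iff_layoutColumn hb1, movesUp_iff_layoutColumn hb2, hC]
    exact ⟨ha1, ha2, hb1, hb2, not_le.2 h1, h2, h4, not_le.2 h3⟩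
  · rintro ⟨q, -, -, a, b, ha1, ha2, hb1, hb2, h1, h2, h3, h4⟩
    rw [movesUp_iff_layoutColumn ‹_›] at h1 h2 h3 h4
    refine ⟨q.1 + q.2 - 1, ha1.1.trans ha1.2, ha2.1.trans ha2.2, a, ⟨ha1, ha2⟩, b, ⟨hb1, hb2⟩,
      q.1, not_le.1 h1, h2, not_le.1 h4, h3⟩

/-! ### Orders without bad pairs give a CDS -/

section OrdersToSegments

variable {R : ℤ × ℤ → ℤ × ℤ → Set (ℤ × ℤ)} {prec : ℤ × ℤ → ℤ → ℤ → Prop}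

theorem upSteps_of_not_haveBadPair (hord : ∀ p, IsStrictTotalOrder ℤ (prec p))
    (hgen : ∀ p, ∀ q ∈ firstQuadrant p, R p q = generatedSegment (prec p) p q)
    (hbad : ∀ p₁ p₂, ¬ HaveBadPair (prec p₁) (prec p₂) p₁ p₂) {p₁ p₂ q : ℤ × ℤ}
    (h₁ : p₁.1 ≤ q.1 ∧ p₁.2 ≤ q.2) (h₂ : p₂.1 ≤ q.1 ∧ p₂.2 ≤ q.2) {a b : ℤ}
    (ha : p₁.1 + p₁.2 ≤ a ∧ p₂.1 + p₂.2 ≤ a ∧ a < q.1 + q.2)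
    (hb : p₁.1 + p₁.2 ≤ b ∧ p₂.1 + p₂.2 ≤ b ∧ b < q.1 + q.2)
    (ha₁ : a ∉ upSteps (R p₁ q)) (ha₂ : a ∈ upSteps (R p₂ q))
    (hb₁ : b ∈ upSteps (R p₁ q)) : b ∈ upSteps (R p₂ q) := by
  by_contra hb₂
  have a1 : a ∈ segInterval p₁ q := mem_segInterval.2 ⟨ha.1, ha.2.2⟩
  have a2 : a ∈ segInterval p₂ q := mem_segInterval.2 ⟨ha.2.1, ha.2.2⟩
  have b1 : b ∈ segInterval p₁ q := mem_segInterval.2 ⟨hb.1, hb.2.2⟩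
  have b2 : b ∈ segInterval p₂ q := mem_segInterval.2 ⟨hb.2.1, hb.2.2⟩
  have := hord p₁
  have := hord p₂
  rw [hgen p₁ q h₁, mem_upSteps_generatedSegment h₁.1 h₁.2 ‹_›] at ha₁ hb₁
  rw [hgen p₂ q h₂, mem_upSteps_generatedSegment h₂.1 h₂.2 ‹_›] at ha₂ hb₂
  exact hbad p₁ p₂ (haveBadPair_iff.2
    ⟨q, h₁, h₂, a, b, a1, a2, b1, b2, ha₁, hb₁, ha₂, hb₂⟩)

theorem isStair_of_generated (hord : ∀ p, IsStrictTotalOrder ℤ (prec p))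
    (hgen : ∀ p, ∀ q ∈ firstQuadrant p, R p q = generatedSegment (prec p) p q)
    {p q : ℤ × ℤ} (h : p.1 ≤ q.1 ∧ p.2 ≤ q.2) : IsStair (R p q) p q := by
  have := hord p
  rw [hgen p q h]
  exact isStair_generatedSegment h.1 h.2

/-- An upper set of diagonals stays an upper set when restricted to a shorter interval. A single
order is involved, so bad pairs play no role. -/
theorem prefix_eq_of_generated (hord : ∀ p, IsStrictTotalOrder ℤ (prec p))
    (hgen : ∀ p, ∀ q ∈ firstQuadrant p, R p q = generatedSegment (prec p) p q)
    {p q s : ℤ × ℤ} (h : p.1 ≤ q.1 ∧ p.2 ≤ q.2) (hs : s ∈ R p q) :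
    R p s = {t ∈ R p q | p.1 + p.2 ≤ t.1 + t.2 ∧ t.1 + t.2 ≤ s.1 + s.2} := by
  have hS := isStair_of_generated hord hgen h
  have hps := hS.left_le s hs
  have hsq := hS.le_right s hs
  have := hord p
  rw [hgen p s hps]
  symm
  refine (hS.sub hS.left_mem hs (by omega)).eq_generatedSegment fun a ha b hb haS hab => ?_
  rw [mem_segInterval] at ha hb
  rw [IsStair.mem_upSteps_sub ha, hgen p q h, mem_upSteps_generatedSegment h.1 h.2
    (mem_segInterval.2 ⟨ha.1, by omega⟩)] at haS
  have hbI : b ∈ segInterval p q := mem_segInterval.2 ⟨hb.1, by omega⟩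
  rw [IsStair.mem_upSteps_sub hb, hgen p q h, mem_upSteps_generatedSegment h.1 h.2 hbI]
  exact haS.of_prec hab hbI

/-- Both paths lead from `r` to `q`, so they have equally many up steps. An up step of only one of
them is matched by an up step of only the other, and the two diagonals form a bad pair. -/
theorem suffix_subset_of_generated (hord : ∀ p, IsStrictTotalOrder ℤ (prec p))
    (hgen : ∀ p, ∀ q ∈ firstQuadrant p, R p q = generatedSegment (prec p) p q)
    (hbad : ∀ p₁ p₂, ¬ HaveBadPair (prec p₁) (prec p₂) p₁ p₂)
    {p q r : ℤ × ℤ} (h : p.1 ≤ q.1 ∧ p.2 ≤ q.2) (hr : r ∈ R p q) : R r q ⊆ R p q := by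
  have hS := isStair_of_generated hord hgen h
  have hpr := hS.left_le r hr
  have hrq := hS.le_right r hr
  have hT := isStair_of_generated hord hgen hrq
  intro t ht
  have hrt := hT.left_le t ht
  refine hT.subset_of_upSteps hS hT.left_mem hr (fun c h1 h2 => ⟨fun hc => ?_, fun hc => ?_⟩)
    t ht (by omega)
  · by_contra hc'
    obtain ⟨b, hb1, hb2, hb, hb'⟩ := exists_upStep_of_card_le hT hS hT.left_mem hT.right_mem hr
      hS.right_mem (by omega) rfl rfl le_rfl h1 h2 hc hc'
    exact hb (upSteps_of_not_haveBadPair hord hgen hbad h hrq (a := c) (b := b)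
      (by omega) (by omega) hc' hc hb')
  · by_contra hc'
    obtain ⟨b, hb1, hb2, hb, hb'⟩ := exists_upStep_of_card_le hS hT hr hS.right_mem hT.left_mem
      hT.right_mem (by omega) rfl rfl le_rfl h1 h2 hc hc'
    exact hb (upSteps_of_not_haveBadPair hord hgen hbad hrq h (a := c) (b := b)
      (by omega) (by omega) hc' hc hb')

theorem sub_subset_of_generated (hord : ∀ p, IsStrictTotalOrder ℤ (prec p))
    (hgen : ∀ p, ∀ q ∈ firstQuadrant p, R p q = generatedSegment (prec p) p q)
    (hbad : ∀ p₁ p₂, ¬ HaveBadPair (prec p₁) (prec p₂) p₁ p₂)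
    {p q r s : ℤ × ℤ} (h : p.1 ≤ q.1 ∧ p.2 ≤ q.2) (hr : r ∈ R p q) (hs : s ∈ R p q)
    (hrs : r.1 ≤ s.1 ∧ r.2 ≤ s.2) : R r s ⊆ R p q := by
  have hS := isStair_of_generated hord hgen h
  have hpr := hS.left_le r hr
  have hps := prefix_eq_of_generated hord hgen h hs
  have hr' : r ∈ R p s := by
    rw [hps]; exact ⟨hr, by omega, by omega⟩
  refine (suffix_subset_of_generated hord hgen hbad (hS.left_le s hs) hr').trans ?_
  rw [hps]
  exact fun t ht => ht.1

theorem mem_extend_right_of_generated (hord : ∀ p, IsStrictTotalOrder ℤ (prec p))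
    (hgen : ∀ p, ∀ q ∈ firstQuadrant p, R p q = generatedSegment (prec p) p q)
    {p q : ℤ × ℤ} (h : p.1 ≤ q.1 ∧ p.2 ≤ q.2) :
    q ∈ R p (q.1, q.2 + 1) ∨ q ∈ R p (q.1 + 1, q.2) := by
  have := hord p
  have h1 : p.1 ≤ (q.1, q.2 + 1).1 ∧ p.2 ≤ (q.1, q.2 + 1).2 := by simp only; omega
  have h2 : p.1 ≤ (q.1 + 1, q.2).1 ∧ p.2 ≤ (q.1 + 1, q.2).2 := by simp only; omega
  have hS := isStair_of_generated hord hgen h1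
  have hT := isStair_of_generated hord hgen h2
  rcases hS.step_back hS.right_mem (by simp only; omega) with h3 | h3
  · left; simpa using h3
  rcases hT.step_back hT.right_mem (by simp only; omega) with h4 | h4
  swap
  · right; simpa using h4
  -- Otherwise the last diagonal has rank below `q.2 - p.2` for one end but not below `q.2 + 1 -
  -- p.2` for the other, although both intervals coincide.
  exfalso
  have hc1 : q.1 + q.2 ∈ segInterval p (q.1, q.2 + 1) :=
    mem_segInterval.2 ⟨by omega, by simp only; omega⟩
  have hc2 : q.1 + q.2 ∈ segInterval p (q.1 + 1, q.2) :=
    mem_segInterval.2 ⟨by omega, by simp only; omega⟩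
  have hup : q.1 + q.2 ∈ upSteps (R p (q.1 + 1, q.2)) :=
    ⟨_, h4, by simp only; omega, by simpa using hT.right_mem⟩
  have hnup : q.1 + q.2 ∉ upSteps (R p (q.1, q.2 + 1)) := by
    have h5 := hS.mem_upSteps h3
    simp only [show q.1 - 1 + (q.2 + 1) = q.1 + q.2 by omega] at h5
    rw [h5]
    exact hS.not_up_of_right (r := (q.1 - 1, q.2 + 1)) (by simpa using hS.right_mem)
  rw [hgen _ _ h1, mem_upSteps_generatedSegment h1.1 h1.2 hc1] at hnup
  rw [hgen _ _ h2, mem_upSteps_generatedSegment h2.1 h2.2 hc2] at hup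
  have hI : segInterval p (q.1, q.2 + 1) = segInterval p (q.1 + 1, q.2) := by
    ext; simp only [mem_segInterval]; omega
  refine hnup ⟨hc1, ?_⟩
  rw [hI]
  exact hup.2.trans (by simp only; omega)

theorem mem_extend_left_of_generated (hord : ∀ p, IsStrictTotalOrder ℤ (prec p))
    (hgen : ∀ p, ∀ q ∈ firstQuadrant p, R p q = generatedSegment (prec p) p q)
    (hbad : ∀ p₁ p₂, ¬ HaveBadPair (prec p₁) (prec p₂) p₁ p₂)
    {p q : ℤ × ℤ} (h : p.1 ≤ q.1 ∧ p.2 ≤ q.2) :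
    p ∈ R (p.1, p.2 - 1) q ∨ p ∈ R (p.1 - 1, p.2) q := by
  have h1 : (p.1, p.2 - 1).1 ≤ q.1 ∧ (p.1, p.2 - 1).2 ≤ q.2 := by simp only; omega
  have h2 : (p.1 - 1, p.2).1 ≤ q.1 ∧ (p.1 - 1, p.2).2 ≤ q.2 := by simp only; omega
  have hS := isStair_of_generated hord hgen h1
  have hT := isStair_of_generated hord hgen h2
  rcases hS.step_of_sum hS.left_mem (by simp only; omega) with h3 | h3
  · left; simpa using h3
  rcases hT.step_of_sum hT.left_mem (by simp only; omega) with h4 | h4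
  swap
  · right; simpa using h4
  exfalso
  have hc1 : p.1 + p.2 - 1 ∉ upSteps (R (p.1, p.2 - 1) q) := by
    have h5 := hS.mem_upSteps hS.left_mem
    simp only [show p.1 + (p.2 - 1) = p.1 + p.2 - 1 by omega] at h5
    rw [h5]
    exact hS.not_up_of_right (r := (p.1, p.2 - 1)) h3
  have hc2 : p.1 + p.2 - 1 ∈ upSteps (R (p.1 - 1, p.2) q) :=
    ⟨_, hT.left_mem, by simp only; omega, h4⟩
  -- The path from the lower start has one more up step in total, yet steps right on the first
  -- diagonal where the other steps up. It must step up alone on some diagonal `b`, which completes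
  -- a bad pair.
  obtain ⟨b, hb1, hb2, hb, hb'⟩ := exists_upStep_of_card_le hT hS hT.left_mem hT.right_mem
    hS.left_mem hS.right_mem (by simp only; omega) (by simp only; omega) rfl
    (by simp only; omega) (a := p.1 + p.2 - 1) (by simp only; omega) (by omega) hc2 hc1
  simp only at hb1
  exact hb (upSteps_of_not_haveBadPair hord hgen hbad h1 h2 (a := p.1 + p.2 - 1) (b := b)
    (by simp only; omega) (by simp only; omega) hc1 hc2 hb')

theorem isNonnegCDS_of_generated (hord : ∀ p, IsStrictTotalOrder ℤ (prec p))
    (hgen : ∀ p, ∀ q ∈ firstQuadrant p, R p q = generatedSegment (prec p) p q)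
    (hbad : ∀ p₁ p₂, ¬ HaveBadPair (prec p₁) (prec p₂) p₁ p₂)
    (hthird : ∀ p, ∀ q ∈ thirdQuadrant p, R p q = R q p) : IsNonnegCDS R := by
  have hsymm (p q : ℤ × ℤ) (h : NonnegSlope p q) : R p q = R q p := by
    rcases h with h | h
    · exact (hthird q p h).symm
    · exact hthird p q h
  have hsub {p q r s : ℤ × ℤ} (h : p.1 ≤ q.1 ∧ p.2 ≤ q.2) (hr : r ∈ R p q) (hs : s ∈ R p q)
      (hrs : NonnegSlope r s) : R r s ⊆ R p q := by
    rcases hrs with h' | h'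
    · exact sub_subset_of_generated hord hgen hbad h hr hs h'
    · rw [hthird r s h']
      exact sub_subset_of_generated hord hgen hbad h hs hr h'
  have hmono {p q : ℤ × ℤ} (h : p.1 ≤ q.1 ∧ p.2 ≤ q.2) (r) (hr : r ∈ R p q) :
      (p.1 ≤ r.1 ∧ p.2 ≤ r.2) ∧ (r.1 ≤ q.1 ∧ r.2 ≤ q.2) :=
    ⟨(isStair_of_generated hord hgen h).left_le r hr,
      (isStair_of_generated hord hgen h).le_right r hr⟩
  refine ⟨?_, hsymm, ?_, ?_, ?_⟩
  · rintro p q (h | h)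
    · exact (isStair_of_generated hord hgen h).isGridPath
    · rw [hthird p q h]
      exact (isStair_of_generated hord hgen h).isGridPath.symm
  · rintro p q (h | h) r hr s hs hrs
    · exact hsub h hr hs hrs
    · rw [hthird p q h] at hr hs ⊢
      exact hsub h hr hs hrs
  · rintro p q (h | h)
    · have hext (r : ℤ × ℤ) (hqr : q.1 ≤ r.1 ∧ q.2 ≤ r.2) (hne : q.1 + q.2 < r.1 + r.2)
          (hq : q ∈ R p r) : ∃ r, NonnegSlope p r ∧ r ∉ R p q ∧ R p q ⊆ R p r := by
        have hpr : p.1 ≤ r.1 ∧ p.2 ≤ r.2 := ⟨h.1.trans hqr.1, h.2.trans hqr.2⟩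
        refine ⟨r, Or.inl hpr, fun hr => ?_, ?_⟩
        · have := hmono h r hr; omega
        · exact hsub hpr (isStair_of_generated hord hgen hpr).left_mem hq (Or.inl h)
      rcases mem_extend_right_of_generated hord hgen h with h' | h'
      · exact hext _ (by simp only; omega) (by simp only; omega) h'
      · exact hext _ (by simp only; omega) (by simp only; omega) h'
    · have hext (r : ℤ × ℤ) (hrq : r.1 ≤ q.1 ∧ r.2 ≤ q.2) (hne : r.1 + r.2 < q.1 + q.2)
          (hq : q ∈ R r p) : ∃ r, NonnegSlope p r ∧ r ∉ R p q ∧ R p q ⊆ R p r := by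
        have hrp : r.1 ≤ p.1 ∧ r.2 ≤ p.2 := ⟨hrq.1.trans h.1, hrq.2.trans h.2⟩
        rw [hthird p q h]
        refine ⟨r, Or.inr hrp, fun hr => ?_, ?_⟩
        · have := hmono h r hr; omega
        · rw [hthird p r hrp]
          exact hsub hrp hq (isStair_of_generated hord hgen hrp).right_mem (Or.inl h)
      rcases mem_extend_left_of_generated hord hgen hbad h with h' | h'
      · exact hext _ (by simp only; omega) (by simp only; omega) h'
      · exact hext _ (by simp only; omega) (by simp only; omega) h'
  · intro p q
    constructor
    · intro e r hr
      rcases le_total p.2 q.2 with h | h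
      · have := hmono ⟨e.le, h⟩ r hr; omega
      · rw [hthird p q ⟨e.ge, h⟩] at hr
        have := hmono ⟨e.ge, h⟩ r hr; omega
    · intro e r hr
      rcases le_total p.1 q.1 with h | h
      · have := hmono ⟨h, e.le⟩ r hr; omega
      · rw [hthird p q ⟨h, e.ge⟩] at hr
        have := hmono ⟨h, e.ge⟩ r hr; omega

end OrdersToSegments

/-! ### Segments of a CDS neither diverge nor cross -/

namespace IsNonnegCDS

variable {R : ℤ × ℤ → ℤ × ℤ → Set (ℤ × ℤ)}

/-- Segments to a common end do not move apart: every point between them would have to be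
prolonged backwards. -/
theorem not_diverge_left (hR : IsNonnegCDS R) {q : ℤ × ℤ} (n : ℕ) : ∀ s r : ℤ × ℤ,
    s.1 ≤ q.1 → s.2 ≤ q.2 → r.1 ≤ q.1 → r.2 ≤ q.2 → r.1 = s.1 + n → r.2 = s.2 - n →
    (s.1, s.2 + 1) ∈ R s q → (r.1 + 1, r.2) ∈ R r q → False := by
  induction n with
  | zero =>
    intro s r hs1 hs2 hr1 hr2 e1 e2 hs hr
    obtain rfl : r = s := by ext <;> push_cast at * <;> omega
    exact (hR.isStair hs1 hs2).not_up_of_right hr hs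
  | succ n ih =>
    intro s r hs1 hs2 hr1 hr2 e1 e2 hs hr
    push_cast at e1 e2
    have hS := hR.isStair hs1 hs2
    have hsq := hS.le_right _ hs
    have ht1 : (s.1 + 1, s.2 - 1).1 ≤ q.1 := by simp only; omega
    have ht2 : (s.1 + 1, s.2 - 1).2 ≤ q.2 := by simp only; omega
    have hT := hR.isStair ht1 ht2
    simp only at hsq
    -- The diagonal neighbour of `s` either steps up and takes over the role of `s`, or steps right.
    -- In the latter case `(s.1 + 1, s.2)` is entered neither from below nor from the left, against
    -- backward prolongation.
    rcases hT.step_of_sum hT.left_mem (by simp only; omega) with h | h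
    · exact ih _ r ht1 ht2 hr1 hr2 (by simp only; omega) (by simp only; omega) h hr
    · rcases hR.exists_extend_left (p := (s.1 + 1, s.2)) (q := q) (by simp only; omega)
        (by simp only; omega) with h' | h'
      · have := hT.eq_of_sum h h' (by simp only; omega)
        simp at this
      · simp only [add_sub_cancel_right] at h'
        have := hS.eq_of_sum hs h' (by simp only; omega)
        simp at this

/-- Mirror image for a common start: if `u` is entered from the left and its diagonal neighbour from
below, the point `(u.1, u.2 - 1)` has no forward prolongation. -/
theorem not_diverge_right (hR : IsNonnegCDS R) {p : ℤ × ℤ} (n : ℕ) : ∀ u v : ℤ × ℤ,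
    p.1 ≤ u.1 → p.2 ≤ u.2 → p.1 ≤ v.1 → p.2 ≤ v.2 → v.1 = u.1 + n → v.2 = u.2 - n →
    (u.1 - 1, u.2) ∈ R p u → (v.1, v.2 - 1) ∈ R p v → False := by
  induction n with
  | zero =>
    intro u v hu1 hu2 hv1 hv2 e1 e2 hu hv
    obtain rfl : v = u := by ext <;> push_cast at * <;> omega
    have := (hR.isStair hu1 hu2).eq_of_sum hu hv (by simp only; omega)
    simp at this
  | succ n ih =>
    intro u v hu1 hu2 hv1 hv2 e1 e2 hu hv
    push_cast at e1 e2
    have hU := hR.isStair hu1 hu2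
    have hpu := hU.left_le _ hu
    have ht1 : p.1 ≤ (u.1 + 1, u.2 - 1).1 := by simp only; omega
    have ht2 : p.2 ≤ (u.1 + 1, u.2 - 1).2 := by simp only; omega
    have hT := hR.isStair ht1 ht2
    simp only at hpu
    rcases hT.step_back hT.right_mem (by simp only; omega) with h | h
    · obtain ⟨r, hr, hr1, hr2, hm⟩ := hR.exists_extend_right (p := p) (q := (u.1, u.2 - 1))
        (by simp only; omega) (by simp only; omega)
      simp only at hr hr1 hr2
      by_cases h1 : r.1 = u.1
      · obtain rfl : r = u := by ext <;> omega
        have := hU.eq_of_sum hu hm (by simp only; omega)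
        simp at this
      · obtain rfl : r = (u.1 + 1, u.2 - 1) := by ext <;> simp only <;> omega
        have := hT.eq_of_sum h hm (by simp only; omega)
        simp at this
    · exact ih _ v ht1 ht2 hv1 hv2 (by simp only; omega) (by simp only; omega) h hv

/-- From the meeting point on, both segments contain the same segment from `t` to `q`. -/
theorem mem_of_meet_left (hR : IsNonnegCDS R) {p p' q t s : ℤ × ℤ} (h : p.1 ≤ q.1 ∧ p.2 ≤ q.2)
    (h' : p'.1 ≤ q.1 ∧ p'.2 ≤ q.2) (ht : t ∈ R p q) (ht' : t ∈ R p' q) (hs : s ∈ R p q)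
    (hts : t.1 + t.2 ≤ s.1 + s.2) : s ∈ R p' q := by
  have hS := hR.isStair h.1 h.2
  have hT := hR.isStair h'.1 h'.2
  have h1 := hS.le_right t ht
  have h2 := hS.le_right s hs
  have e := hR.seg_eq h.1 h.2 ht hS.right_mem (by omega)
  rw [hR.seg_eq h'.1 h'.2 ht' hT.right_mem (by omega)] at e
  exact (e.symm.subset ⟨hs, hts, by omega⟩).1

theorem mem_of_meet_right (hR : IsNonnegCDS R) {p q q' t s : ℤ × ℤ} (h : p.1 ≤ q.1 ∧ p.2 ≤ q.2)
    (h' : p.1 ≤ q'.1 ∧ p.2 ≤ q'.2) (ht : t ∈ R p q) (ht' : t ∈ R p q') (hs : s ∈ R p q)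
    (hst : s.1 + s.2 ≤ t.1 + t.2) : s ∈ R p q' := by
  have hS := hR.isStair h.1 h.2
  have hT := hR.isStair h'.1 h'.2
  have h1 := hS.left_le t ht
  have h2 := hS.left_le s hs
  have e := hR.seg_eq h.1 h.2 hS.left_mem ht (by omega)
  rw [hR.seg_eq h'.1 h'.2 hT.left_mem ht' (by omega)] at e
  exact (e.symm.subset ⟨hs, by omega, hst⟩).1

/-- Segments to a common end do not cross. -/
theorem not_cross_left (hR : IsNonnegCDS R) {p p' q r r' s s' : ℤ × ℤ}
    (h : p.1 ≤ q.1 ∧ p.2 ≤ q.2) (h' : p'.1 ≤ q.1 ∧ p'.2 ≤ q.2) (hr : r ∈ R p q)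
    (hr' : r' ∈ R p' q) (er : r.1 + r.2 = r'.1 + r'.2) (hle : r.1 ≤ r'.1) (hs : s ∈ R p q)
    (hs' : s' ∈ R p' q) (es : s.1 + s.2 = s'.1 + s'.2) (hrs : r.1 + r.2 ≤ s.1 + s.2) :
    s.1 ≤ s'.1 := by
  have hS := hR.isStair h.1 h.2
  have hT := hR.isStair h'.1 h'.2
  obtain ⟨c, hc⟩ : ∃ c, s.1 + s.2 = c := ⟨_, rfl⟩
  rw [hc] at hrs
  induction c, hrs using Int.leInduction generalizing s s' with
  | base =>
    rwa [hS.eq_of_sum hs hr hc, hT.eq_of_sum hs' hr' (by omega)]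
  | succ c hrc ih =>
    have h1 := hS.left_le r hr
    have h2 := hS.le_right s hs
    have h3 := hT.left_le r' hr'
    obtain ⟨t, ht, et⟩ := hS.exists_sum (c := c) (by omega) (by omega)
    obtain ⟨t', ht', et'⟩ := hT.exists_sum (c := c) (by omega) (by omega)
    have htt := ih ht ht' (by omega) et
    rcases htt.lt_or_eq with hlt | heq
    · have h4 := hS.le_of_sum ht hs (by omega)
      have h5 := hT.le_of_sum ht' hs' (by omega)
      omega
    · obtain rfl : t = t' := by ext <;> omega
      have := hR.mem_of_meet_left h h' ht ht' hs (by omega)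
      rw [hT.eq_of_sum this hs' es]

theorem not_cross_right (hR : IsNonnegCDS R) {p q q' r r' s s' : ℤ × ℤ}
    (h : p.1 ≤ q.1 ∧ p.2 ≤ q.2) (h' : p.1 ≤ q'.1 ∧ p.2 ≤ q'.2) (hs : s ∈ R p q)
    (hs' : s' ∈ R p q') (es : s.1 + s.2 = s'.1 + s'.2) (hle : s.1 ≤ s'.1) (hr : r ∈ R p q)
    (hr' : r' ∈ R p q') (er : r.1 + r.2 = r'.1 + r'.2) (hrs : r.1 + r.2 ≤ s.1 + s.2) :
    r.1 ≤ r'.1 := by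
  have hS := hR.isStair h.1 h.2
  have hT := hR.isStair h'.1 h'.2
  obtain ⟨c, hc⟩ : ∃ c, s.1 + s.2 = c := ⟨_, rfl⟩
  rw [hc] at hrs
  by_contra! hlt
  -- A strict reversal on the earlier diagonal persists: if the paths met later, they would share
  -- everything before the meeting point.
  suffices hmain : ∀ c, r.1 + r.2 ≤ c → ∀ s ∈ R p q, ∀ s' ∈ R p q', s.1 + s.2 = c →
      s'.1 + s'.2 = c → s'.1 < s.1 by
    exact absurd (hmain c hrs s hs s' hs' hc (by omega)) (by omega)
  clear hle es hs hs' hc hrs s s' c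
  intro c hrc
  induction c, hrc using Int.leInduction with
  | base =>
    intro s hs s' hs' e e'
    rwa [hS.eq_of_sum hs hr e, hT.eq_of_sum hs' hr' (by omega)]
  | succ c hrc ih =>
    intro s hs s' hs' e e'
    have h1 := hS.left_le r hr
    have h2 := hS.le_right s hs
    have h3 := hT.left_le r' hr'
    have h4 := hT.le_right s' hs'
    obtain ⟨t, ht, et⟩ := hS.exists_sum (c := c) (by omega) (by omega)
    obtain ⟨t', ht', et'⟩ := hT.exists_sum (c := c) (by omega) (by omega)
    have htt := ih t ht t' ht' et et'
    have h5 := hS.le_of_sum ht hs (by omega)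
    have h6 := hT.le_of_sum ht' hs' (by omega)
    by_contra! hle
    obtain rfl : s = s' := by ext <;> omega
    have := hR.mem_of_meet_right h h' hs hs' ht (by omega)
    rw [hT.eq_of_sum this ht' (by omega)] at htt
    exact lt_irrefl _ htt

/-- The path stepping right must be the upper left one; otherwise the tails to `q` would coincide
and then split, or move apart. -/
theorem lt_of_opposite_steps (hR : IsNonnegCDS R) {p p' q r r' : ℤ × ℤ}
    (h : p.1 ≤ q.1 ∧ p.2 ≤ q.2) (h' : p'.1 ≤ q.1 ∧ p'.2 ≤ q.2) (hr : r ∈ R p q)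
    (hr' : r' ∈ R p' q) (er : r.1 + r.2 = r'.1 + r'.2) (hright : (r.1 + 1, r.2) ∈ R p q)
    (hup : (r'.1, r'.2 + 1) ∈ R p' q) : r.1 < r'.1 := by
  by_contra! hle
  have hS := hR.isStair h.1 h.2
  have hT := hR.isStair h'.1 h'.2
  have h1 := hS.le_right _ hright
  have h2 := hT.le_right _ hup
  simp only at h1 h2
  obtain ⟨n, hn⟩ := Int.eq_ofNat_of_zero_le (show 0 ≤ r.1 - r'.1 by omega)
  refine hR.not_diverge_left (q := q) n r' r (by omega) (by omega) (by omega) (by omega)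
    (by omega) (by omega) ?_ ?_
  · rw [hR.seg_eq h'.1 h'.2 hr' hT.right_mem (by omega)]
    exact ⟨hup, by simp only; omega, by simp only; omega⟩
  · rw [hR.seg_eq h.1 h.2 hr hS.right_mem (by omega)]
    exact ⟨hright, by simp only; omega, by simp only; omega⟩

theorem not_opposite_pair (hR : IsNonnegCDS R) {p p' q : ℤ × ℤ}
    (h : p.1 ≤ q.1 ∧ p.2 ≤ q.2) (h' : p'.1 ≤ q.1 ∧ p'.2 ≤ q.2) {a b : ℤ}
    (ha : a ∈ segInterval p q) (ha' : a ∈ segInterval p' q) (hb : b ∈ segInterval p q)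
    (hb' : b ∈ segInterval p' q) (haS : a ∉ upSteps (R p q)) (haT : a ∈ upSteps (R p' q))
    (hbS : b ∈ upSteps (R p q)) (hbT : b ∉ upSteps (R p' q)) : False := by
  rw [mem_segInterval] at ha ha' hb hb'
  have hS := hR.isStair h.1 h.2
  have hT := hR.isStair h'.1 h'.2
  obtain ⟨r, hr, er⟩ := hS.exists_sum (c := a) (by omega) (by omega)
  obtain ⟨r', hr', er'⟩ := hT.exists_sum (c := a) (by omega) (by omega)
  obtain ⟨s, hs, es⟩ := hS.exists_sum (c := b) (by omega) (by omega)
  obtain ⟨s', hs', es'⟩ := hT.exists_sum (c := b) (by omega) (by omega)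
  rw [← er] at haS
  rw [← er', hT.mem_upSteps hr'] at haT
  rw [← es, hS.mem_upSteps hs] at hbS
  rw [← es'] at hbT
  have h1 := hR.lt_of_opposite_steps h h' hr hr' (by omega)
    (hS.right_of_notMem hr (by omega) haS) haT
  have h2 := hR.lt_of_opposite_steps h' h hs' hs (by omega)
    (hT.right_of_notMem hs' (by omega) hbT) hbS
  -- The strict left-to-right orders on diagonals `a` and `b` are opposite, so the segments would
  -- have crossed in between.
  rcases le_total a b with hab | hab
  · have := hR.not_cross_left h h' hr hr' (by omega) h1.le hs hs' (by omega) (by omega)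
    omega
  · have := hR.not_cross_left h' h hs' hs (by omega) h2.le hr' hr (by omega) (by omega)
    omega

/-- On a diagonal, moving the end to the right removes up steps. -/
theorem upSteps_anti (hR : IsNonnegCDS R) {p q q' : ℤ × ℤ} (h : p.1 ≤ q.1 ∧ p.2 ≤ q.2)
    (h' : p.1 ≤ q'.1 ∧ p.2 ≤ q'.2) (e : q.1 + q.2 = q'.1 + q'.2) (hle : q.1 ≤ q'.1) {c : ℤ}
    (hc : p.1 + p.2 ≤ c) (hcq : c < q.1 + q.2) (hup : c ∈ upSteps (R p q')) :
    c ∈ upSteps (R p q) := by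
  have hS := hR.isStair h.1 h.2
  have hT := hR.isStair h'.1 h'.2
  obtain ⟨r, hr, er⟩ := hS.exists_sum (c := c) (by omega) (by omega)
  obtain ⟨r', hr', er'⟩ := hT.exists_sum (c := c) (by omega) (by omega)
  by_contra hnup
  rw [← er', hT.mem_upSteps hr'] at hup
  rw [← er] at hnup
  have hright := hS.right_of_notMem hr (by omega) hnup
  have h0 := hS.left_le r hr
  have h0' := hT.left_le r' hr'
  have h1 := hR.not_cross_right h h' hS.right_mem hT.right_mem e hle hright hup
    (by simp only; omega) (by simp only; omega)
  simp only at h1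
  obtain ⟨n, hn⟩ := Int.eq_ofNat_of_zero_le (show 0 ≤ r'.1 - (r.1 + 1) by omega)
  refine hR.not_diverge_right (p := p) n (r.1 + 1, r.2) (r'.1, r'.2 + 1) (by simp only; omega)
    (by simp only; omega) (by simp only; omega) (by simp only; omega) (by simp only; omega)
    (by simp only; omega) ?_ ?_
  · rw [hR.seg_eq h.1 h.2 hS.left_mem hright (by simp only; omega)]
    exact ⟨by simpa using hr, by simp only; omega, by simp only; omega⟩
  · rw [hR.seg_eq h'.1 h'.2 hT.left_mem hup (by simp only; omega)]
    exact ⟨by simpa using hr', by simp only; omega, by simp only; omega⟩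

/-- Brings segments from one start to a common final diagonal, where `upSteps_anti` can compare
them. -/
theorem exists_prolong (hR : IsNonnegCDS R) {p q : ℤ × ℤ} (h : p.1 ≤ q.1 ∧ p.2 ≤ q.2) {N : ℤ}
    (hN : q.1 + q.2 ≤ N) : ∃ r : ℤ × ℤ, (p.1 ≤ r.1 ∧ p.2 ≤ r.2) ∧ r.1 + r.2 = N ∧
      ∀ c, p.1 + p.2 ≤ c → c < q.1 + q.2 → (c ∈ upSteps (R p r) ↔ c ∈ upSteps (R p q)) := by
  induction N, hN using Int.leInduction with
  | base => exact ⟨q, h, rfl, fun _ _ _ => Iff.rfl⟩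
  | succ N hN ih =>
    obtain ⟨r, hr, er, hup⟩ := ih
    obtain ⟨r', er', h1, h2, hmem⟩ := hR.exists_extend_right hr.1 hr.2
    have hr' : p.1 ≤ r'.1 ∧ p.2 ≤ r'.2 := ⟨hr.1.trans h1, hr.2.trans h2⟩
    refine ⟨r', hr', by omega, fun c hc1 hc2 => ?_⟩
    rw [← hup c hc1 hc2, hR.seg_eq hr'.1 hr'.2 (hR.isStair hr'.1 hr'.2).left_mem hmem (by omega),
      IsStair.mem_upSteps_sub ⟨hc1, by omega⟩]

end IsNonnegCDS

/-! ### The orders induced by a CDS -/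

/-- The order of `p` induced by a system of segments: `a` precedes `b` if some segment from `p` to
a point in the first quadrant moves right at `a` and up at `b`. Below `p` the order is that of
`ℤ`. -/
def inducedOrder (R : ℤ × ℤ → ℤ × ℤ → Set (ℤ × ℤ)) (p : ℤ × ℤ) (a b : ℤ) : Prop :=
  (p.1 + p.2 ≤ a ∧ p.1 + p.2 ≤ b ∧ ∃ q : ℤ × ℤ, (p.1 ≤ q.1 ∧ p.2 ≤ q.2) ∧ a < q.1 + q.2 ∧
    b < q.1 + q.2 ∧ a ∉ upSteps (R p q) ∧ b ∈ upSteps (R p q)) ∨ (a < p.1 + p.2 ∧ a < b)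

namespace IsNonnegCDS

variable {R : ℤ × ℤ → ℤ × ℤ → Set (ℤ × ℤ)}

theorem inducedOrder_trans (hR : IsNonnegCDS R) {p : ℤ × ℤ} {a b c : ℤ}
    (hab : inducedOrder R p a b) (hbc : inducedOrder R p b c) : inducedOrder R p a c := by
  rcases hab with ⟨ha, hb, q, hq, haq, hbq, ha', hb'⟩ | hab
  · rcases hbc with ⟨-, hc, q', hq', hbq', hcq, hb'', hc'⟩ | hbc
    · left
      obtain ⟨r, hr, er, hup⟩ := hR.exists_prolong hq (le_max_left _ (q'.1 + q'.2))
      obtain ⟨r', hr', er', hup'⟩ := hR.exists_prolong hq' (le_max_right (q.1 + q.2) _)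
      rw [← hup a ha haq] at ha'
      rw [← hup b hb hbq] at hb'
      rw [← hup' b hb hbq'] at hb''
      rw [← hup' c hc hcq] at hc'
      -- If `r` is to the left, it inherits the up step at `c` and witnesses the relation. If `r'`
      -- is to the left, it inherits the up step at `b`, which it does not have.
      rcases le_total r.1 r'.1 with hle | hle
      · exact ⟨ha, hc, r, hr, by omega, by omega, ha',
          hR.upSteps_anti hr hr' (by omega) hle hc (by omega) hc'⟩
      · exact absurd (hR.upSteps_anti hr' hr (by omega) hle hb (by omega) hb') hb''
    · omega
  · rcases hbc with hbc | hbc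
    · exact Or.inr ⟨hab.1, by omega⟩
    · exact Or.inr ⟨hab.1, by omega⟩

theorem inducedOrder_irrefl (R : ℤ × ℤ → ℤ × ℤ → Set (ℤ × ℤ)) (p : ℤ × ℤ) (a : ℤ) :
    ¬ inducedOrder R p a a := by
  rintro (⟨-, -, q, -, -, -, h, h'⟩ | h)
  · exact h h'
  · omega

theorem inducedOrder_total (hR : IsNonnegCDS R) {p : ℤ × ℤ} {a b : ℤ}
    (hab : ¬ inducedOrder R p a b) (hba : ¬ inducedOrder R p b a) : a = b := by
  classical
  by_contra hne
  by_cases ha : p.1 + p.2 ≤ a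
  swap
  · rcases lt_or_gt_of_ne hne with h | h
    · exact hab (Or.inr ⟨by omega, h⟩)
    · exact hba (Or.inr ⟨by omega, h⟩)
  by_cases hb : p.1 + p.2 ≤ b
  swap
  · exact hba (Or.inr ⟨by omega, by omega⟩)
  obtain ⟨n, hn⟩ := Int.eq_ofNat_of_zero_le (show 0 ≤ max a b + 1 - (p.1 + p.2) by omega)
  -- The ends sweep one diagonal beyond `a` and `b`, from straight above `p` to straight right of
  -- it. The up-step sets are nested and lose one element per move, so `a` and `b`, which always
  -- agree, can never drop out; but at the last end no up steps remain.
  let Q : ℕ → ℤ × ℤ := fun k => (p.1 + k, p.2 + n - k)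
  have hQ (k : ℕ) (hk : k ≤ n) : p.1 ≤ (Q k).1 ∧ p.2 ≤ (Q k).2 := by simp only [Q]; omega
  have hQsum (k : ℕ) : (Q k).1 + (Q k).2 = p.1 + p.2 + n := by simp only [Q]; omega
  have hiff (k : ℕ) (hk : k ≤ n) : a ∈ upSteps (R p (Q k)) ↔ b ∈ upSteps (R p (Q k)) := by
    constructor
    · intro h
      by_contra h'
      exact hba (Or.inl ⟨hb, ha, Q k, hQ k hk, by rw [hQsum]; omega, by rw [hQsum]; omega, h', h⟩)
    · intro h
      by_contra h'
      exact hab (Or.inl ⟨ha, hb, Q k, hQ k hk, by rw [hQsum]; omega, by rw [hQsum]; omega, h', h⟩)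
  have hcard (k : ℕ) (hk : k ≤ n) : (((Finset.Ico (p.1 + p.2) (p.1 + p.2 + n)).filter
      (· ∈ upSteps (R p (Q k)))).card : ℤ) = n - k := by
    have hS := hR.isStair (hQ k hk).1 (hQ k hk).2
    have := hS.card_upSteps hS.left_mem hS.right_mem (by rw [hQsum]; omega)
    rw [hQsum] at this
    rw [this]; simp only [Q]; ring
  have haI : a ∈ Finset.Ico (p.1 + p.2) (p.1 + p.2 + n) := by rw [Finset.mem_Ico]; omega
  have hbI : b ∈ Finset.Ico (p.1 + p.2) (p.1 + p.2 + n) := by rw [Finset.mem_Ico]; omega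
  have hall (k : ℕ) (hk : k ≤ n) : a ∈ upSteps (R p (Q k)) := by
    induction k with
    | zero =>
      have h := hcard 0 hk
      have h2 := Finset.eq_of_subset_of_card_le (Finset.filter_subset
        (· ∈ upSteps (R p (Q 0))) (Finset.Ico (p.1 + p.2) (p.1 + p.2 + n)))
        (by rw [Int.card_Ico]; push_cast at h; omega)
      rw [← h2, Finset.mem_filter] at haI
      exact haI.2
    | succ k ih =>
      have hak := ih (by omega)
      by_contra hak'
      have hsub : insert a (insert b ((Finset.Ico (p.1 + p.2) (p.1 + p.2 + n)).filter
          (· ∈ upSteps (R p (Q (k + 1)))))) ⊆ (Finset.Ico (p.1 + p.2) (p.1 + p.2 + n)).filter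
          (· ∈ upSteps (R p (Q k))) := by
        intro c hc
        rw [Finset.mem_insert, Finset.mem_insert] at hc
        rw [Finset.mem_filter]
        rcases hc with rfl | rfl | hc
        · exact ⟨haI, hak⟩
        · exact ⟨hbI, (hiff k (by omega)).1 hak⟩
        · rw [Finset.mem_filter, Finset.mem_Ico] at hc
          refine ⟨Finset.mem_Ico.2 hc.1, hR.upSteps_anti (hQ k (by omega)) (hQ (k + 1) hk) ?_ ?_
            hc.1.1 ?_ hc.2⟩
          · rw [hQsum, hQsum]
          · simp only [Q]; push_cast; omega
          · rw [hQsum]; exact hc.1.2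
      have hle := Finset.card_le_card hsub
      have hak'' := hak'
      rw [hiff (k + 1) hk] at hak''
      rw [Finset.card_insert_of_notMem (by
          rw [Finset.mem_insert, Finset.mem_filter]; exact not_or.2 ⟨hne, fun h => hak' h.2⟩),
        Finset.card_insert_of_notMem (by
          rw [Finset.mem_filter]; exact fun h => hak'' h.2)] at hle
      have h1 := hcard k (by omega)
      have h2 := hcard (k + 1) hk
      push_cast at h2
      omega
  have hlast := hcard n le_rfl
  rw [sub_self, Nat.cast_eq_zero, Finset.card_eq_zero, Finset.filter_eq_empty_iff] at hlast
  exact hlast haI (hall n le_rfl)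

theorem isStrictTotalOrder_inducedOrder (hR : IsNonnegCDS R) (p : ℤ × ℤ) :
    IsStrictTotalOrder ℤ (inducedOrder R p) where
  trichotomous _ _ := hR.inducedOrder_total
  irrefl := inducedOrder_irrefl R p
  trans _ _ _ := hR.inducedOrder_trans

theorem eq_generatedSegment (hR : IsNonnegCDS R) (p : ℤ × ℤ) {q : ℤ × ℤ}
    (h : p.1 ≤ q.1 ∧ p.2 ≤ q.2) : R p q = generatedSegment (inducedOrder R p) p q := by
  have := hR.isStrictTotalOrder_inducedOrder p
  refine (hR.isStair h.1 h.2).eq_generatedSegment fun a ha b hb haS hab => ?_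
  rw [mem_segInterval] at ha hb
  by_contra hbS
  -- The segment itself witnesses the reverse relation.
  have hba : inducedOrder R p b a := Or.inl ⟨hb.1, ha.1, q, h, hb.2, ha.2, hbS, haS⟩
  exact inducedOrder_irrefl R p a (hR.inducedOrder_trans hab hba)

theorem not_haveBadPair (hR : IsNonnegCDS R) (p₁ p₂ : ℤ × ℤ) :
    ¬ HaveBadPair (inducedOrder R p₁) (inducedOrder R p₂) p₁ p₂ := by
  have := hR.isStrictTotalOrder_inducedOrder p₁
  have := hR.isStrictTotalOrder_inducedOrder p₂
  rw [haveBadPair_iff]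
  rintro ⟨q, h₁, h₂, a, b, ha₁, ha₂, hb₁, hb₂, ha, hb, ha', hb'⟩
  rw [← mem_upSteps_generatedSegment h₁.1 h₁.2 ‹_›, ← hR.eq_generatedSegment p₁ h₁] at ha hb
  rw [← mem_upSteps_generatedSegment h₂.1 h₂.2 ‹_›, ← hR.eq_generatedSegment p₂ h₂] at ha' hb'
  exact hR.not_opposite_pair h₁ h₂ ha₁ ha₂ hb₁ hb₂ ha ha' hb hb'

end IsNonnegCDS

theorem theorem1 (R : ℤ × ℤ → ℤ × ℤ → Set (ℤ × ℤ)) :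
    IsNonnegCDS R ↔
      ∃ prec : ℤ × ℤ → ℤ → ℤ → Prop,
        (∀ p, IsStrictTotalOrder ℤ (prec p)) ∧
        (∀ p, ∀ q ∈ firstQuadrant p, R p q = generatedSegment (prec p) p q) ∧
        (∀ p₁ p₂, ¬ HaveBadPair (prec p₁) (prec p₂) p₁ p₂) ∧
        (∀ p, ∀ q ∈ thirdQuadrant p, R p q = R q p) := by
  constructor
  · intro hR
    exact ⟨inducedOrder R, hR.isStrictTotalOrder_inducedOrder,
      fun p q hq => hR.eq_generatedSegment p hq, hR.not_haveBadPair,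
      fun p q hq => hR.symmetry p q (Or.inr hq)⟩
  · rintro ⟨prec, hord, hgen, hbad, hthird⟩
    exact isNonnegCDS_of_generated hord hgen hbad hthird
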